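/- Let a rectangle mean a closed axis-parallel rectangle $[x_1,x_2]\times[y_1,y_2]$ in the plane with $x_1<x_2$ and $y_1<y_2$. For a family $\mathcal F$ of shapes in $\mathbb R^2$, a point set $P\subseteq\mathbb R^2$ is called $\mathcal F$-piercing if it intersects every translate $x+S$ ($S\in\mathcal F$, $x\in\mathbb R^2$). Let $D_r$ be the disk of radius $r$ centered at the origin, let $$\underline\delta(P)=\liminf_{r\to\infty}\frac{|P\cap D_r|}{\operatorname{Area}(D_r)},\qquad \overline\delta(P)=\limsup_{r\to\infty}\frac{|P\cap D_r|}{\operatorname{Area}(D_r)},$$ and let $\pi_T(\mathcal F)=\inf\{\underline\delta(P) : P \text{ is } \mathcal F\text{-piercing}\}$ be the translative piercing density of $\mathcal F$. There is an algorithm that, given the coordinates of any two rectangles $R_1,R_2$, computes in $O(1)$ time (on a unit-cost real RAM with arithmetic operations, comparisons and the floor function; the bound on the number of steps and the program do not depend on the rectangles) a $1.086$-approximation of $\pi_T(\mathcal F)$ for $\mathcal F=\{R_1,R_2\}$, together with a piercing set attaining it. Precisely, the output consists of two linearly independent vectors $u,v\in\mathbb R^2$ and a number $d>0$ such that the lattice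 $\Lambda=\mathbb Zu+\mathbb Zv$ is $\mathcal F$-piercing, $\underline\delta(\Lambda)=\overline\delta(\Lambda)=d$, and $$\pi_T(\mathcal F)\;\le\; d\;\le\;\Bigl(\tfrac52-\sqrt2\Bigr)\,\pi_T(\mathcal F),\qquad\text{where } \tfrac52-\sqrt2<1.086 .$$ -/

import Mathlib

open scoped Pointwise ENNReal

/-! ### Piercing sets and densities in the plane -/

/-- The Euclidean plane. -/
abbrev Plane : Type := EuclideanSpace ℝ (Fin 2)

/-- `P` is `F`-piercing: it meets every translate `x + S` of every member `S` of `F`. -/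
def IsPiercing (F : Set (Set Plane)) (P : Set Plane) : Prop :=
  ∀ S ∈ F, ∀ x : Plane, ∃ p ∈ P, p ∈ x +ᵥ S

/-- The density `|P ∩ D| / Area(D)` of a point set `P` over a domain `D`; it is `∞` when
`P ∩ D` is infinite and `D` is bounded. -/
noncomputable def densityOver (P D : Set Plane) : ℝ≥0∞ :=
  ((P ∩ D).encard : ℝ≥0∞) / MeasureTheory.volume D

/-- Asymptotic upper density, over disks centered at the origin. -/
noncomputable def upperDensity (P : Set Plane) : ℝ≥0∞ :=
  Filter.limsup (fun r : ℝ => densityOver P (Metric.closedBall 0 r)) Filter.atTop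

/-- Asymptotic lower density, over disks centered at the origin. -/
noncomputable def lowerDensity (P : Set Plane) : ℝ≥0∞ :=
  Filter.liminf (fun r : ℝ => densityOver P (Metric.closedBall 0 r)) Filter.atTop

/-- The translative piercing density: the infimum of the lower densities of all `F`-piercing
point sets. -/
noncomputable def piercingDensity (F : Set (Set Plane)) : ℝ≥0∞ :=
  ⨅ (P : Set Plane) (_ : IsPiercing F P), lowerDensity P

/-- The set of integer combinations of `u` and `v`. It is a lattice with basis `{u, v}` when
`u` and `v` are linearly independent over `ℝ`. -/
def latticePoints (u v : Plane) : Set Plane :=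
  (Submodule.span ℤ ({u, v} : Set Plane) : Set Plane)

/-- Coordinates of a nondegenerate axis-parallel rectangle `[x₁, x₂] × [y₁, y₂]`. -/
structure AxisRect where
  x₁ : ℝ
  x₂ : ℝ
  y₁ : ℝ
  y₂ : ℝ
  hx : x₁ < x₂
  hy : y₁ < y₂

/-- The closed rectangle as a subset of the plane. -/
def AxisRect.toSet (R : AxisRect) : Set Plane :=
  {p | p 0 ∈ Set.Icc R.x₁ R.x₂ ∧ p 1 ∈ Set.Icc R.y₁ R.y₂}

/-- The four numbers by which a rectangle is presented to an algorithm. -/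
def AxisRect.coords (R : AxisRect) : List ℝ := [R.x₁, R.x₂, R.y₁, R.y₂]

/-! ### The unit-cost real random access machine

The registers hold real numbers. One step executes one instruction: an assignment of an integer
constant, a copy, an arithmetic operation, a floor operation, or a conditional jump. -/

namespace RealRAM

/-- Instructions; the first register argument of an assignment is its destination. -/
inductive Instr where
  | const (dst : ℕ) (z : ℤ)
  | copy (dst i : ℕ)
  | add (dst i j : ℕ)
  | sub (dst i j : ℕ)
  | mul (dst i j : ℕ)
  | div (dst i j : ℕ)
  | floor (dst i : ℕ)
  /-- Jump to `target` if register `i` is at most register `j`, otherwise fall through. -/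
  | jumpLE (i j target : ℕ)
  | halt

/-- A program is a finite list of instructions. -/
abbrev Program : Type := List Instr

/-- A machine state: the program counter and the contents of the registers. -/
structure State where
  pc : ℕ
  reg : ℕ → ℝ

/-- Store `x` in register `dst` and go to the next instruction. -/
noncomputable def State.assign (s : State) (dst : ℕ) (x : ℝ) : State :=
  ⟨s.pc + 1, Function.update s.reg dst x⟩

open Classical in
/-- Effect of one instruction. There is no successor state after `halt` or when a division by
zero is attempted. -/
noncomputable def Instr.exec (s : State) : Instr → Option State
  | .const dst z => some (s.assign dst z)
  | .copy dst i => some (s.assign dst (s.reg i))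
  | .add dst i j => some (s.assign dst (s.reg i + s.reg j))
  | .sub dst i j => some (s.assign dst (s.reg i - s.reg j))
  | .mul dst i j => some (s.assign dst (s.reg i * s.reg j))
  | .div dst i j => if s.reg j = 0 then none else some (s.assign dst (s.reg i / s.reg j))
  | .floor dst i => some (s.assign dst (⌊s.reg i⌋ : ℝ))
  | .jumpLE i j target =>
      if s.reg i ≤ s.reg j then some ⟨target, s.reg⟩ else some ⟨s.pc + 1, s.reg⟩
  | .halt => none

/-- One step of a program; there is none when the program counter is outside the program. -/
noncomputable def step (prog : Program) (s : State) : Option State :=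
  (prog[s.pc]?).bind (Instr.exec s)

/-- The state after exactly `n` steps, if all of them can be carried out. -/
noncomputable def run (prog : Program) : ℕ → State → Option State
  | 0, s => some s
  | n + 1, s => (step prog s).bind (run prog n)

/-- Initial state: the input fills the first registers and all the others hold `0`. -/
noncomputable def init (input : List ℝ) : State :=
  ⟨0, fun i => input.getD i 0⟩

/-- On the given input the program reaches a `halt` instruction, in the state `s`, after at most
`T` steps. -/
def HaltsWithin (prog : Program) (input : List ℝ) (T : ℕ) (s : State) : Prop :=
  ∃ n ≤ T, run prog n (init input) = some s ∧ prog[s.pc]? = some Instr.halt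

end RealRAM

/-! Piercing depends only on the side lengths of the rectangles. If one rectangle fits into the
other, only the smaller one matters. Otherwise one is wider and the other taller, and rescaling the
axes makes the sizes `a × 1` and `1 × b` with `a, b ≥ 1`. A piercing lattice of determinant `D` has
density `1 / D`, so `D` should be as large as possible.

If `a ≤ ⌊b⌋`, a lattice of rows of determinant `a` pierces both (`LatticeMeets.rows`). It is
optimal, since piercing the boxes `a × 1` alone already requires density `1 / a`
(`inv_area_le_lowerDensity`). The case `b ≤ ⌊a⌋` is symmetric. In the remaining case `a = n + x` and
`b = n + y` with a common integer part `n` and `0 < x, y < 1`. Two lattices compete: the rows for `n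
× 1` and `1 × n`, of determinant `n`, and a skew lattice of determinant `1 + (a - 1)(b - 1) / n`
(`LatticeMeets.skew`). Conversely, every piercing set has lower density at least `1 / (n + xy)`
(`inv_le_lowerDensity_of_meetsBoxes`). This is an averaging argument with a weight of integral `n +
xy` on an `a × b` box, each translate of which collects weight at least `1` from the set. Comparing
`n + xy` with the larger determinant gives the factor `5/2 - √2`, whose critical case is `n = 2`
(`le_ratio_mul`).

The choice among these lattices is a fixed expression with comparisons and floors in the eight
coordinates. Such expressions compile to straight-line code with forward jumps
(`exists_haltsWithin_programOf`), so the number of steps is bounded by the length of the program. -/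

namespace RealRAM

/-! ### Compiling real expressions to the machine -/

/-- `Reaches prog T s s'`: the program leads from `s` to `s'` in at most `T` steps. -/
def Reaches (prog : Program) (T : ℕ) (s s' : State) : Prop :=
  ∃ n ≤ T, run prog n s = some s'

theorem run_add (prog : Program) (m n : ℕ) (s : State) :
    run prog (m + n) s = (run prog m s).bind (run prog n) := by
  induction m generalizing s with
  | zero => simp [run]
  | succ m ih =>
    rw [Nat.succ_add]
    simp only [run]
    cases step prog s with
    | none => rfl
    | some t => simp [ih]

theorem Reaches.refl (prog : Program) (s : State) : Reaches prog 0 s s :=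
  ⟨0, le_rfl, rfl⟩

theorem Reaches.trans {prog : Program} {S T : ℕ} {s t u : State}
    (h₁ : Reaches prog S s t) (h₂ : Reaches prog T t u) : Reaches prog (S + T) s u := by
  obtain ⟨m, hm, h₁⟩ := h₁
  obtain ⟨n, hn, h₂⟩ := h₂
  exact ⟨m + n, by omega, by rw [run_add, h₁]; exact h₂⟩

theorem Reaches.mono {prog : Program} {S T : ℕ} {s t : State}
    (h : Reaches prog S s t) (hST : S ≤ T) : Reaches prog T s t := by
  obtain ⟨m, hm, h⟩ := h
  exact ⟨m, hm.trans hST, h⟩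

theorem Reaches.of_exec {prog : Program} {s s' : State} {i : Instr}
    (hi : prog[s.pc]? = some i) (h : i.exec s = some s') : Reaches prog 1 s s' :=
  ⟨1, le_rfl, by simp [run, step, hi, h]⟩

/-- The instructions `c` stand in the program from position `off` on. -/
def CodeAt (prog : Program) : ℕ → List Instr → Prop
  | _, [] => True
  | off, i :: c => prog[off]? = some i ∧ CodeAt prog (off + 1) c

theorem codeAt_append {prog : Program} {off : ℕ} {c d : List Instr} :
    CodeAt prog off (c ++ d) ↔ CodeAt prog off c ∧ CodeAt prog (off + c.length) d := by
  induction c generalizing off with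
  | nil => simp [CodeAt]
  | cons i c ih =>
    simp only [List.cons_append, CodeAt, ih, List.length_cons, and_assoc]
    rw [show off + 1 + c.length = off + (c.length + 1) by omega]

theorem codeAt_length_append (p c : List Instr) : CodeAt (p ++ c) p.length c := by
  induction c generalizing p with
  | nil => trivial
  | cons i c ih =>
    refine ⟨by simp, ?_⟩
    simpa using ih (p ++ [i])

theorem codeAt_self (c : List Instr) : CodeAt c 0 c :=
  codeAt_length_append [] c

/-- Real expressions in numbered variables, with a conditional: `ite a b c d` stands for `c` if
`a ≤ b` and for `d` otherwise. -/
inductive Expr where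
  | var (i : ℕ)
  | const (z : ℤ)
  | add (a b : Expr)
  | sub (a b : Expr)
  | mul (a b : Expr)
  | div (a b : Expr)
  | floor (a : Expr)
  | ite (a b c d : Expr)

namespace Expr

open Classical in
/-- Value of an expression. -/
noncomputable def eval (env : ℕ → ℝ) : Expr → ℝ
  | var i => env i
  | const z => z
  | add a b => a.eval env + b.eval env
  | sub a b => a.eval env - b.eval env
  | mul a b => a.eval env * b.eval env
  | div a b => a.eval env / b.eval env
  | floor a => (⌊a.eval env⌋ : ℝ)
  | ite a b c d => if a.eval env ≤ b.eval env then c.eval env else d.eval env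

/-- Only variables below `N` occur, and no denominator vanishes. -/
def Defined (N : ℕ) (env : ℕ → ℝ) : Expr → Prop
  | var i => i < N
  | const _ => True
  | add a b => a.Defined N env ∧ b.Defined N env
  | sub a b => a.Defined N env ∧ b.Defined N env
  | mul a b => a.Defined N env ∧ b.Defined N env
  | div a b => a.Defined N env ∧ b.Defined N env ∧ b.eval env ≠ 0
  | floor a => a.Defined N env
  | ite a b c d => a.Defined N env ∧ b.Defined N env ∧ c.Defined N env ∧ d.Defined N env

/-- Number of instructions in the compiled expression. -/
def size : Expr → ℕ
  | var _ => 1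
  | const _ => 1
  | add a b => a.size + b.size + 1
  | sub a b => a.size + b.size + 1
  | mul a b => a.size + b.size + 1
  | div a b => a.size + b.size + 1
  | floor a => a.size + 1
  | ite a b c d => a.size + b.size + 1 + d.size + 1 + c.size

/-- Code which, placed at position `off`, computes an expression into register `dst`, with the
registers above `dst` as work space. -/
def code : Expr → ℕ → ℕ → List Instr
  | var i, _, dst => [.copy dst i]
  | const z, _, dst => [.const dst z]
  | add a b, off, dst =>
      a.code off dst ++ b.code (off + a.size) (dst + 1) ++ [.add dst dst (dst + 1)]
  | sub a b, off, dst =>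
      a.code off dst ++ b.code (off + a.size) (dst + 1) ++ [.sub dst dst (dst + 1)]
  | mul a b, off, dst =>
      a.code off dst ++ b.code (off + a.size) (dst + 1) ++ [.mul dst dst (dst + 1)]
  | div a b, off, dst =>
      a.code off dst ++ b.code (off + a.size) (dst + 1) ++ [.div dst dst (dst + 1)]
  | floor a, off, dst => a.code off dst ++ [.floor dst dst]
  | ite a b c d, off, dst =>
      a.code off dst ++ b.code (off + a.size) (dst + 1) ++
        [.jumpLE dst (dst + 1) (off + a.size + b.size + 1 + d.size + 1)] ++
        d.code (off + a.size + b.size + 1) dst ++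
        -- A register is at most itself, so this jump is unconditional; it skips the code of `c`.
        [.jumpLE dst dst (off + a.size + b.size + 1 + d.size + 1 + c.size)] ++
        c.code (off + a.size + b.size + 1 + d.size + 1) dst

@[simp]
theorem length_code (e : Expr) (off dst : ℕ) : (e.code off dst).length = e.size := by
  induction e generalizing off dst with
  | var | const => rfl
  | add a b iha ihb | sub a b iha ihb | mul a b iha ihb | div a b iha ihb =>
    simp [code, size, iha, ihb]; omega
  | floor a iha => simp [code, size, iha]
  | ite a b c d iha ihb ihc ihd => simp [code, size, iha, ihb, ihc, ihd]; omega

/-- What the code of an expression achieves from the state `s`. -/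
def Computes (prog : Program) (env : ℕ → ℝ) (e : Expr) (dst : ℕ) (s : State) : Prop :=
  ∃ s', Reaches prog e.size s s' ∧ s'.pc = s.pc + e.size ∧ s'.reg dst = e.eval env ∧
    ∀ i < dst, s'.reg i = s.reg i

/-- The part shared by all binary operations and the comparison. The second operand is computed from
`dst + 1` upwards, so the first one survives in `dst`. -/
theorem exists_reaches_pair {prog : Program} {N : ℕ} {env : ℕ → ℝ} {a b : Expr} {dst : ℕ}
    {s : State} (hN : N ≤ dst) (hs : ∀ i < N, s.reg i = env i)
    (ha : Computes prog env a dst s)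
    (hb : ∀ t : State, t.pc = s.pc + a.size → (∀ i < N, t.reg i = env i) →
      Computes prog env b (dst + 1) t) :
    ∃ s', Reaches prog (a.size + b.size) s s' ∧ s'.pc = s.pc + a.size + b.size ∧
      s'.reg dst = a.eval env ∧ s'.reg (dst + 1) = b.eval env ∧
      ∀ i < dst, s'.reg i = s.reg i := by
  obtain ⟨t, ht, htpc, htd, htr⟩ := ha
  obtain ⟨u, hu, hupc, hud, hur⟩ := hb t htpc fun i hi ↦ by rw [htr i (by omega), hs i hi]
  refine ⟨u, ht.trans hu, by rw [hupc, htpc], ?_, hud, fun i hi ↦ ?_⟩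
  · rw [hur dst (by omega), htd]
  · rw [hur i (by omega), htr i hi]

/-- Registers are used as a stack: nothing below `dst` is written, so the variables, which lie below
`N ≤ dst`, stay readable throughout. All jumps go forward, which bounds the steps by the code size.
-/
theorem computes_of_codeAt {prog : Program} {N : ℕ} {env : ℕ → ℝ} (e : Expr)
    (he : e.Defined N env) {dst : ℕ} (hN : N ≤ dst) {s : State}
    (hc : CodeAt prog s.pc (e.code s.pc dst)) (hs : ∀ i < N, s.reg i = env i) :
    Computes prog env e dst s := by
  induction e generalizing dst s with
  | var i =>
    refine ⟨_, Reaches.of_exec hc.1 rfl, rfl, ?_, fun j hj ↦ ?_⟩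
    · simp [State.assign, eval, hs i he]
    · simp [State.assign, hj.ne]
  | const z =>
    refine ⟨_, Reaches.of_exec hc.1 rfl, rfl, ?_, fun j hj ↦ ?_⟩
    · simp [State.assign, eval]
    · simp [State.assign, hj.ne]
  | add a b iha ihb | sub a b iha ihb | mul a b iha ihb =>
    simp only [code, codeAt_append, length_code, List.length_append] at hc
    obtain ⟨⟨hca, hcb⟩, hci, -⟩ := hc
    obtain ⟨t, ht, htpc, hta, htb, htr⟩ := exists_reaches_pair hN hs (iha he.1 hN hca hs)
      fun t ht hte ↦ ihb he.2 (by omega) (by rw [ht]; exact hcb) hte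
    refine ⟨_, ht.trans (Reaches.of_exec (by rw [htpc, add_assoc]; exact hci) rfl), ?_, ?_,
      fun j hj ↦ ?_⟩
    · simp [State.assign, htpc, size]; omega
    · simp [State.assign, hta, htb, eval]
    · simp [State.assign, hj.ne, htr j hj]
  | div a b iha ihb =>
    simp only [code, codeAt_append, length_code, List.length_append] at hc
    obtain ⟨⟨hca, hcb⟩, hci, -⟩ := hc
    obtain ⟨t, ht, htpc, hta, htb, htr⟩ := exists_reaches_pair hN hs (iha he.1 hN hca hs)
      fun t ht hte ↦ ihb he.2.1 (by omega) (by rw [ht]; exact hcb) hte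
    refine ⟨_, ht.trans (Reaches.of_exec (by rw [htpc, add_assoc]; exact hci)
      (by rw [Instr.exec, if_neg (by rw [htb]; exact he.2.2)])), ?_, ?_, fun j hj ↦ ?_⟩
    · simp [State.assign, htpc, size]; omega
    · simp [State.assign, hta, htb, eval]
    · simp [State.assign, hj.ne, htr j hj]
  | floor a iha =>
    simp only [code, codeAt_append, length_code] at hc
    obtain ⟨hca, hci, -⟩ := hc
    obtain ⟨t, ht, htpc, hta, htr⟩ := iha he hN hca hs
    refine ⟨_, ht.trans (Reaches.of_exec (by rw [htpc]; exact hci) rfl), ?_, ?_, fun j hj ↦ ?_⟩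
    · simp [State.assign, htpc, size]; omega
    · simp [State.assign, hta, eval]
    · simp [State.assign, hj.ne, htr j hj]
  | ite a b c d iha ihb ihc ihd =>
    simp only [code, codeAt_append, length_code, List.length_append, List.length_singleton] at hc
    obtain ⟨⟨⟨⟨⟨hca, hcb⟩, hci, -⟩, hcd⟩, hcj, -⟩, hcc⟩ := hc
    obtain ⟨hea, heb, hec, hed⟩ := he
    obtain ⟨t, ht, htpc, hta, htb, htr⟩ := exists_reaches_pair hN hs (iha hea hN hca hs)
      fun t ht hte ↦ ihb heb (by omega) (by rw [ht]; exact hcb) hte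
    rw [← add_assoc, ← htpc] at hci
    have hte : ∀ i < N, t.reg i = env i := fun i hi ↦ by rw [htr i (by omega), hs i hi]
    by_cases hab : a.eval env ≤ b.eval env
    · obtain ⟨u, hu, hupc, huc, hur⟩ := ihc hec hN
        (s := ⟨s.pc + a.size + b.size + 1 + d.size + 1, t.reg⟩)
        (by convert hcc using 1; simp only; omega) hte
      refine ⟨u, ((ht.trans (Reaches.of_exec hci ?_)).trans hu).mono ?_, ?_, ?_, fun j hj ↦ ?_⟩
      · rw [Instr.exec, if_pos (by rw [hta, htb]; exact hab), htpc]
      · simp only [size]; omega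
      · rw [hupc]; simp only [size]; omega
      · rw [huc, eval, if_pos hab]
      · rw [hur j hj]; exact htr j hj
    · obtain ⟨u, hu, hupc, hud, hur⟩ := ihd hed hN
        (s := ⟨t.pc + 1, t.reg⟩)
        (by rw [htpc]; convert hcd using 1; simp only; omega) hte
      rw [show s.pc + (a.size + b.size + 1 + d.size) = u.pc by simp only [hupc, htpc]; omega] at hcj
      refine ⟨_, ((ht.trans (Reaches.of_exec hci ?_)).trans hu).trans
        (Reaches.of_exec hcj (by rw [Instr.exec, if_pos le_rfl])) |>.mono ?_, ?_, ?_,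
        fun j hj ↦ ?_⟩
      · rw [Instr.exec, if_neg (by rw [hta, htb]; exact hab)]
      · simp only [size]; omega
      · simp only [size]; omega
      · simp only [hud, eval, if_neg hab]
      · simp only [hur j hj]; exact htr j hj

end Expr

/-- Code that computes a list of expressions into consecutive registers. -/
def codeList : List Expr → ℕ → ℕ → List Instr
  | [], _, _ => []
  | e :: l, off, dst => e.code off dst ++ codeList l (off + e.size) (dst + 1)

theorem exists_reaches_codeList {prog : Program} {N : ℕ} {env : ℕ → ℝ} (l : List Expr)
    (hl : ∀ e ∈ l, e.Defined N env) {dst : ℕ} (hN : N ≤ dst) {s : State}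
    (hc : CodeAt prog s.pc (codeList l s.pc dst)) (hs : ∀ i < N, s.reg i = env i) :
    ∃ s', Reaches prog (codeList l s.pc dst).length s s' ∧
      s'.pc = s.pc + (codeList l s.pc dst).length ∧
      (∀ i (hi : i < l.length), s'.reg (dst + i) = l[i].eval env) ∧
      ∀ i < dst, s'.reg i = s.reg i := by
  induction l generalizing dst s with
  | nil => exact ⟨s, Reaches.refl _ _, rfl, by simp, by simp⟩
  | cons e l ih =>
    simp only [codeList, codeAt_append, Expr.length_code] at hc
    obtain ⟨t, ht, htpc, htd, htr⟩ :=
      e.computes_of_codeAt (hl e (by simp)) hN hc.1 hs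
    obtain ⟨u, hu, hupc, hud, hur⟩ := ih (fun e he ↦ hl e (by simp [he])) (dst := dst + 1)
      (by omega) (s := t) (by rw [htpc]; exact hc.2)
      (fun i hi ↦ by rw [htr i (by omega), hs i hi])
    rw [htpc] at hu hupc
    refine ⟨u, ?_, ?_, ?_, fun i hi ↦ ?_⟩
    · simpa [codeList] using ht.trans hu
    · simp [codeList, hupc]; omega
    · rintro (_ | i) hi
      · simpa [htd] using hur dst (by omega)
      · have := hud i (by simpa using hi)
        rw [show dst + (i + 1) = dst + 1 + i by omega, this]
        simp
    · rw [hur i (by omega), htr i hi]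

/-- Program that computes five expressions in the registers below `N` and returns them in the
registers `0`, …, `4`. -/
def programOf (N : ℕ) (l : List Expr) : Program :=
  -- The offset `N + 5` keeps the results clear of the inputs, still needed by later expressions,
  -- and of registers `0` to `4`, so that no final copy overwrites a result not yet copied.
  codeList l 0 (N + 5) ++
    [.copy 0 (N + 5), .copy 1 (N + 6), .copy 2 (N + 7), .copy 3 (N + 8), .copy 4 (N + 9), .halt]

theorem exists_haltsWithin_programOf {N : ℕ} {a b c d e : Expr} {input : List ℝ}
    (h : ∀ t ∈ [a, b, c, d, e], t.Defined N (input.getD · 0)) :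
    ∃ s, HaltsWithin (programOf N [a, b, c, d, e]) input
        (programOf N [a, b, c, d, e]).length s ∧
      s.reg 0 = a.eval (input.getD · 0) ∧ s.reg 1 = b.eval (input.getD · 0) ∧
      s.reg 2 = c.eval (input.getD · 0) ∧ s.reg 3 = d.eval (input.getD · 0) ∧
      s.reg 4 = e.eval (input.getD · 0) := by
  have hcode := codeAt_self (programOf N [a, b, c, d, e])
  rw [programOf, codeAt_append] at hcode
  obtain ⟨hc, h0, h1, h2, h3, h4, h5, -⟩ := hcode
  obtain ⟨t, ht, htpc, htd, -⟩ := exists_reaches_codeList (N := N) _ h (dst := N + 5) (by omega)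
    (s := init input) hc (fun i _ ↦ rfl)
  have e0 := htd 0 (by simp)
  have e1 := htd 1 (by simp)
  have e2 := htd 2 (by simp)
  have e3 := htd 3 (by simp)
  have e4 := htd 4 (by simp)
  simp only [List.getElem_cons_zero, List.getElem_cons_succ, add_zero, add_assoc,
    Nat.reduceAdd] at e0 e1 e2 e3 e4
  replace htpc : t.pc = 0 + (codeList [a, b, c, d, e] 0 (N + 5)).length := htpc
  rw [← htpc] at h0 h1 h2 h3 h4 h5
  have r := ht.trans <| (((((Reaches.of_exec h0 rfl).trans (Reaches.of_exec h1 rfl)).trans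
    (Reaches.of_exec h2 rfl)).trans (Reaches.of_exec h3 rfl)).trans (Reaches.of_exec h4 rfl))
  obtain ⟨n, hn, r⟩ := r
  refine ⟨_, ⟨n, hn.trans ?_, r, h5⟩, ?_⟩
  · simp [programOf, init]
  · simp [State.assign, Function.update, e0, e1, e2, e3, e4]

end RealRAM

/-! ### Density of a lattice -/

open MeasureTheory Filter Topology Module

theorem mem_latticePoints {u v x : Plane} :
    x ∈ latticePoints u v ↔ ∃ i j : ℤ, i • u + j • v = x := by
  simp only [latticePoints, SetLike.mem_coe]
  exact Submodule.mem_span_pair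

/-- The determinant of two vectors of the plane. -/
def planeDet (u v : Plane) : ℝ := u 0 * v 1 - u 1 * v 0

theorem linearIndependent_of_planeDet_ne_zero {u v : Plane} (h : planeDet u v ≠ 0) :
    LinearIndependent ℝ ![u, v] := by
  rw [LinearIndependent.pair_iff]
  intro s t hst
  have h0 := congrArg (fun x : Plane ↦ x 0) hst
  have h1 := congrArg (fun x : Plane ↦ x 1) hst
  simp at h0 h1
  constructor
  · refine (mul_eq_zero.1 (?_ : s * planeDet u v = 0)).resolve_right h
    rw [planeDet]; linear_combination v 1 * h0 - v 0 * h1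
  · refine (mul_eq_zero.1 (?_ : t * planeDet u v = 0)).resolve_right h
    rw [planeDet]; linear_combination u 0 * h1 - u 1 * h0

theorem volume_closedBall_plane (x : Plane) {r : ℝ} (hr : 0 ≤ r) :
    volume (Metric.closedBall x r) = ENNReal.ofReal (Real.pi * r ^ 2) := by
  rw [EuclideanSpace.volume_closedBall_fin_two, ← ENNReal.ofReal_pow hr,
    ← ENNReal.ofReal_mul (by positivity), mul_comm]

theorem frontier_closedBall_null (r : ℝ) (hr : r ≠ 0) :
    volume (frontier (Metric.closedBall (0 : Plane) r)) = 0 := by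
  rw [frontier_closedBall _ hr]
  exact Measure.addHaar_sphere_of_ne_zero _ _ hr

/-- The number of lattice points in a growing disk is asymptotic to its area divided by the
covolume, and the covolume is the absolute value of the determinant. -/
theorem tendsto_densityOver_latticePoints {u v : Plane} (h : planeDet u v ≠ 0) :
    Tendsto (fun r : ℝ ↦ densityOver (latticePoints u v) (Metric.closedBall 0 r)) atTop
      (𝓝 (ENNReal.ofReal |planeDet u v|⁻¹)) := by
  have hli := linearIndependent_of_planeDet_ne_zero h
  let b : Basis (Fin 2) ℝ Plane := basisOfLinearIndependentOfCardEqFinrank hli (by simp)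
  have hb : (b : Fin 2 → Plane) = ![u, v] := coe_basisOfLinearIndependentOfCardEqFinrank _ _
  let L : Submodule ℤ Plane := Submodule.span ℤ (Set.range b)
  have hL : (L : Set Plane) = latticePoints u v := by
    simp only [L, hb, latticePoints, Matrix.range_cons, Matrix.range_empty, Set.union_empty]
    rfl
  have hcov : ZLattice.covolume L = |planeDet u v| := by
    rw [ZLattice.covolume_eq_det_mul_measureReal L volume (b.restrictScalars ℤ)
      (EuclideanSpace.basisFun (Fin 2) ℝ).toBasis]
    rw [measureReal_congr (ZSpan.fundamentalDomain_ae_parallelepiped _ _), measureReal_def,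
      OrthonormalBasis.coe_toBasis, OrthonormalBasis.volume_parallelepiped, ENNReal.toReal_one,
      mul_one]
    have hb' : ((↑) ∘ b.restrictScalars ℤ : Fin 2 → Plane) = ![u, v] := by
      rw [← hb]
      ext1 i
      exact b.restrictScalars_apply ℤ i
    rw [hb', Basis.det_apply, Matrix.det_fin_two]
    simp [Basis.toMatrix_apply, planeDet, mul_comm]
  -- The counting theorem wants a function homogeneous of degree equal to the dimension, hence the
  -- squared norm; its sublevel set at `r ^ 2` is the disk of radius `r`.
  have key := ZLattice.covolume.tendsto_card_le_div' L (X := Set.univ) (F := fun x ↦ ‖x‖ ^ 2)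
    (by simp) (fun x r hr ↦ by simp [norm_smul, mul_pow])
  have hset : ∀ c : ℝ, 0 ≤ c → {x ∈ (Set.univ : Set Plane) | ‖x‖ ^ 2 ≤ c} =
      Metric.closedBall 0 (Real.sqrt c) := by
    intro c hc
    ext x
    simp [Real.le_sqrt, hc]
  rw [hset 1 zero_le_one, Real.sqrt_one, hcov] at key
  replace key := key Metric.isBounded_closedBall Metric.isClosed_closedBall.measurableSet
    (frontier_closedBall_null 1 one_ne_zero)
  rw [measureReal_def, volume_closedBall_plane _ zero_le_one,
    ENNReal.toReal_ofReal (by positivity)] at key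
  have key2 := ENNReal.tendsto_ofReal ((key.comp (tendsto_pow_atTop two_ne_zero)).div_const Real.pi)
  have : Real.pi * 1 ^ 2 / |planeDet u v| / Real.pi = |planeDet u v|⁻¹ := by
    field_simp
  rw [this] at key2
  refine key2.congr' ?_
  filter_upwards [eventually_gt_atTop 0] with r hr
  have hfin : (latticePoints u v ∩ Metric.closedBall 0 r).Finite := by
    rw [Set.inter_comm, ← hL]
    exact ZSpan.setFinite_inter b Metric.isBounded_closedBall
  simp only [Function.comp_apply]
  rw [hset _ (by positivity), Real.sqrt_sq hr.le, densityOver, volume_closedBall_plane _ hr.le,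
    hL, Set.inter_comm,
    Nat.card_coe_set_eq, ← hfin.cast_ncard_eq, div_div, ENNReal.ofReal_div_of_pos (by positivity)]
  simp [mul_comm]

theorem lowerDensity_latticePoints {u v : Plane} (h : planeDet u v ≠ 0) :
    lowerDensity (latticePoints u v) = ENNReal.ofReal |planeDet u v|⁻¹ :=
  (tendsto_densityOver_latticePoints h).liminf_eq

theorem upperDensity_latticePoints {u v : Plane} (h : planeDet u v ≠ 0) :
    upperDensity (latticePoints u v) = ENNReal.ofReal |planeDet u v|⁻¹ :=
  (tendsto_densityOver_latticePoints h).limsup_eq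

/-! ### Lower bounds for densities by averaging -/

/-- Boundary effects of bounded width do not affect densities. -/
theorem tendsto_volume_closedBall_div (ρ : ℝ) :
    Tendsto (fun r : ℝ ↦ volume (Metric.closedBall (0 : Plane) (r - ρ)) /
      volume (Metric.closedBall (0 : Plane) r)) atTop (𝓝 1) := by
  have h : Tendsto (fun r : ℝ ↦ ENNReal.ofReal ((1 - ρ / r) ^ 2)) atTop (𝓝 1) := by
    rw [← ENNReal.ofReal_one]
    refine ENNReal.tendsto_ofReal ?_
    have h0 : Tendsto (fun r : ℝ ↦ ρ / r) atTop (𝓝 0) := tendsto_const_nhds.div_atTop tendsto_id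
    simpa using (h0.const_sub 1).pow 2
  refine h.congr' ?_
  filter_upwards [eventually_gt_atTop 0, eventually_ge_atTop ρ] with r hr hrρ
  rw [volume_closedBall_plane _ hr.le, volume_closedBall_plane _ (sub_nonneg.2 hrρ),
    ← ENNReal.ofReal_div_of_pos (by positivity)]
  congr 1
  field_simp

/-- If every translate of the weight `φ` has total weight at least `1` on `P`, then the lower
density of `P` is at least the inverse of the integral of `φ`. -/
theorem inv_lintegral_le_lowerDensity {P : Set Plane} {φ : Plane → ℝ≥0∞} (hφ : Measurable φ)
    {ρ : ℝ} (hsupp : ∀ x, ρ < ‖x‖ → φ x = 0)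
    (hP : ∀ z : Plane, ∀ F : Finset Plane, (F : Set Plane) ⊆ P →
      (∀ p ∈ P, φ (p - z) ≠ 0 → p ∈ F) → 1 ≤ ∑ p ∈ F, φ (p - z)) :
    (∫⁻ x, φ x)⁻¹ ≤ lowerDensity P := by
  have hlim : Tendsto (fun r : ℝ ↦ (∫⁻ x, φ x)⁻¹ * (volume (Metric.closedBall (0 : Plane) (r - ρ)) /
      volume (Metric.closedBall (0 : Plane) r))) atTop (𝓝 ((∫⁻ x, φ x)⁻¹)) := by
    simpa using ENNReal.Tendsto.const_mul (tendsto_volume_closedBall_div ρ)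
      (Or.inl one_ne_zero) (a := (∫⁻ x, φ x)⁻¹)
  rw [← hlim.liminf_eq]
  refine liminf_le_liminf ?_
  filter_upwards with r
  rw [densityOver, ← mul_div_assoc]
  refine ENNReal.div_le_div_right ?_ _
  by_cases hfin : (P ∩ Metric.closedBall 0 r).Finite
  swap
  · rw [Set.not_finite.1 hfin |>.encard_eq]
    exact le_top
  rw [hfin.encard_eq_coe_toFinset_card, mul_comm, ← div_eq_mul_inv]
  refine ENNReal.div_le_of_le_mul ?_
  -- Double counting: for `z` in the disk of radius `r - ρ`, all points of `P` seen by the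
  -- translated weight lie in the disk of radius `r`, and each point contributes at most the full
  -- integral of `φ`.
  calc volume (Metric.closedBall (0 : Plane) (r - ρ))
      = ∫⁻ z in Metric.closedBall (0 : Plane) (r - ρ), 1 := by simp
    _ ≤ ∫⁻ z in Metric.closedBall (0 : Plane) (r - ρ), ∑ p ∈ hfin.toFinset, φ (p - z) := by
      refine setLIntegral_mono' Metric.isClosed_closedBall.measurableSet fun z hz ↦ ?_
      refine hP z _ (fun p hp ↦ ((hfin.mem_toFinset).1 hp).1) fun p hp hne ↦ ?_
      rw [hfin.mem_toFinset]
      refine ⟨hp, ?_⟩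
      rw [mem_closedBall_zero_iff] at hz ⊢
      have : ‖p - z‖ ≤ ρ := not_lt.1 fun h ↦ hne (hsupp _ h)
      calc ‖p‖ = ‖(p - z) + z‖ := by simp
        _ ≤ ‖p - z‖ + ‖z‖ := norm_add_le _ _
        _ ≤ r := by linarith
    _ ≤ ∫⁻ z, ∑ p ∈ hfin.toFinset, φ (p - z) := setLIntegral_le_lintegral _ _
    _ = ∑ p ∈ hfin.toFinset, ∫⁻ z, φ (p - z) :=
      lintegral_finsetSum _ fun p _ ↦ hφ.comp (measurable_const.sub measurable_id)
    _ = (hfin.toFinset.card : ℝ≥0∞) * ∫⁻ x, φ x := by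
      simp [lintegral_sub_left_eq_self]

/-- The closed box `[x, x + W] × [y, y + H]`. -/
def closedBox (x y W H : ℝ) : Set Plane :=
  {p | p 0 ∈ Set.Icc x (x + W) ∧ p 1 ∈ Set.Icc y (y + H)}

/-- `P` meets every closed box of width `W` and height `H`. -/
def MeetsBoxes (P : Set Plane) (W H : ℝ) : Prop :=
  ∀ x y, ∃ p ∈ P, p ∈ closedBox x y W H

theorem measurableSet_closedBox (x y W H : ℝ) : MeasurableSet (closedBox x y W H) := by
  unfold closedBox
  measurability

theorem volume_closedBox (x y : ℝ) {W H : ℝ} (hW : 0 ≤ W) :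
    volume (closedBox x y W H) = ENNReal.ofReal (W * H) := by
  have : closedBox x y W H = (WithLp.ofLp : Plane → Fin 2 → ℝ) ⁻¹'
      Set.Icc ![x, y] ![x + W, y + H] := by
    ext p
    simp [closedBox, Pi.le_def, Fin.forall_fin_two]
    tauto
  rw [this, (PiLp.volume_preserving_ofLp (Fin 2)).measure_preimage
    measurableSet_Icc.nullMeasurableSet, Real.volume_Icc_pi]
  simp [ENNReal.ofReal_mul hW]

theorem norm_le_of_mem_closedBox {W H x y w h : ℝ} {p : Plane} (hp : p ∈ closedBox x y w h)
    (hx : 0 ≤ x) (hy : 0 ≤ y) (hW : x + w ≤ W) (hH : y + h ≤ H) : ‖p‖ ≤ W + H := by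
  obtain ⟨⟨h1, h2⟩, h3, h4⟩ := hp
  rw [EuclideanSpace.norm_eq, Fin.sum_univ_two, Real.norm_eq_abs, Real.norm_eq_abs, sq_abs, sq_abs]
  refine Real.sqrt_le_iff.2 ⟨by linarith, ?_⟩
  nlinarith [mul_nonneg (hx.trans h1) (hy.trans h3)]

/-- The averaging bound with the indicator of one box as weight. -/
theorem inv_area_le_lowerDensity {P : Set Plane} {W H : ℝ} (hW : 0 < W) (hH : 0 < H)
    (hP : MeetsBoxes P W H) : ENNReal.ofReal (W * H)⁻¹ ≤ lowerDensity P := by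
  have hm := measurableSet_closedBox 0 0 W H
  have := inv_lintegral_le_lowerDensity (P := P) (φ := (closedBox 0 0 W H).indicator 1)
    (ρ := W + H) (measurable_one.indicator hm) (fun x hx ↦ ?_) (fun z F hF hzF ↦ ?_)
  · rw [lintegral_indicator_one hm, volume_closedBox _ _ hW.le,
      ← ENNReal.ofReal_inv_of_pos (by positivity)] at this
    exact this
  · refine Set.indicator_of_notMem (fun hmem ↦ hx.not_ge ?_) _
    exact norm_le_of_mem_closedBox hmem le_rfl le_rfl (by simp) (by simp)
  · obtain ⟨p, hp, hpz⟩ := hP (z 0) (z 1)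
    have hmem : p - z ∈ closedBox 0 0 W H := by
      simp only [closedBox, Set.mem_Icc, Set.mem_ofPred_eq, PiLp.sub_apply] at hpz ⊢
      refine ⟨⟨?_, ?_⟩, ?_, ?_⟩ <;> linarith
    have h1 : (closedBox 0 0 W H).indicator (1 : Plane → ℝ≥0∞) (p - z) = 1 := by
      simp [hmem]
    have hpF : p ∈ F := hzF p hp (by rw [h1]; exact one_ne_zero)
    rw [← h1]
    exact Finset.single_le_sum (f := fun p ↦ (closedBox 0 0 W H).indicator (1 : Plane → ℝ≥0∞) (p - z))
      (fun _ _ ↦ zero_le) hpF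

/-! ### Pairs of a wide and a tall rectangle with equal integer parts -/

section Counting

variable {α : Type*} {F : Finset α} {f : α → ℝ}

/-- A finite set that meets every unit interval within `(t, β]` has at least `k` points there if
`k < β - t`. -/
theorem le_card_filter_of_meets_unit_intervals {t β : ℝ}
    (hF : ∀ s, t < s → s + 1 ≤ β → ∃ p ∈ F, f p ∈ Set.Icc s (s + 1)) {k : ℕ}
    (hk : k = 0 ∨ (k : ℝ) < β - t) : k ≤ (F.filter fun p ↦ t < f p).card := by
  induction k generalizing t with
  | zero => exact Nat.zero_le _
  | succ k ih =>
    have hk' : (k : ℝ) + 1 < β - t := by simpa using hk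
    have hk0 : (0 : ℝ) ≤ k := k.cast_nonneg
    -- Half of the slack: shifting by `ε` makes the point found lie strictly beyond `t`, and still
    -- leaves more than length `k` to its right.
    set ε := (β - t - (k + 1)) / 2 with hε
    have hεpos : 0 < ε := by linarith
    obtain ⟨p, hp, hp1, hp2⟩ := hF (t + ε) (by linarith) (by linarith)
    have h := ih (t := t + ε + 1) (fun s hs hs' ↦ hF s (by linarith) hs')
      (Or.inr (by linarith))
    refine h.trans_lt (Finset.card_lt_card ?_)
    refine (Finset.ssubset_iff_of_subset fun q hq ↦ ?_).2 ⟨p, ?_, ?_⟩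
    · simp only [Finset.mem_filter] at hq ⊢
      exact ⟨hq.1, by linarith [hq.2]⟩
    · simp only [Finset.mem_filter]
      exact ⟨hp, by linarith⟩
    · simp only [Finset.mem_filter, not_and, not_lt]
      exact fun _ ↦ hp2

variable {n : ℕ} {y : ℝ}

theorem le_card_of_meets_unit_intervals (hy : 0 < y)
    (hF : ∀ s, 0 ≤ s → s + 1 ≤ n + y → ∃ p ∈ F, f p ∈ Set.Icc s (s + 1)) : n ≤ F.card :=
  (le_card_filter_of_meets_unit_intervals (t := 0) (fun s hs ↦ hF s hs.le)
    (Or.inr (by linarith))).trans (Finset.card_filter_le _ _)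

/-- A point with value in the gap between `i` and `i + y` leaves length more than `i` before it and
more than `n - i` after it. This forces `i` points strictly before and `n - i` strictly after it,
hence `n + 1` in total. At the ends, where `i = 0` or `i = n`, one of the counts is zero and needs
no length. -/
theorem lt_card_of_meets_unit_intervals
    (hF : ∀ s, 0 ≤ s → s + 1 ≤ n + y → ∃ p ∈ F, f p ∈ Set.Icc s (s + 1)) {p : α} (hp : p ∈ F)
    (h0 : 0 ≤ f p) (h1 : f p ≤ n + y) (hy : 0 < y) (hy1 : y < 1)
    (hbad : ∀ i < n, ¬ (i + y ≤ f p ∧ f p ≤ i + 1)) : n < F.card := by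
  obtain ⟨i, hin, hi, hi'⟩ : ∃ i ≤ n, (i = 0 ∨ (i : ℝ) < f p) ∧ (n - i = 0 ∨ f p < i + y) := by
    rcases h0.eq_or_lt with h | h
    · exact ⟨0, n.zero_le, Or.inl rfl, Or.inr (by simpa [← h] using hy)⟩
    · obtain ⟨i, hi⟩ : ∃ i, ⌈f p⌉₊ = i + 1 := Nat.exists_eq_succ_of_ne_zero (by simpa using h)
      have h2 : (i : ℝ) < f p := Nat.lt_ceil.1 (by omega)
      have h3 : f p ≤ i + 1 := by simpa [hi] using Nat.le_ceil (f p)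
      have h4 : i < n + 1 := by
        have : (i : ℝ) < n + 1 := by linarith
        exact_mod_cast this
      refine ⟨i, by omega, Or.inr h2, ?_⟩
      rcases (Nat.lt_succ_iff.1 h4).eq_or_lt with h5 | h5
      · exact Or.inl (by omega)
      · exact Or.inr (not_le.1 fun h6 ↦ hbad i h5 ⟨h6, h3⟩)
  have hup := le_card_filter_of_meets_unit_intervals (F := F) (f := f) (t := f p) (β := n + y)
    (fun s hs hs' ↦ hF s (by linarith) hs') (k := n - i)
    (hi'.imp_right fun h ↦ by rw [Nat.cast_sub hin]; linarith)
  -- The points before `p` are counted by reflection.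
  have hdown := le_card_filter_of_meets_unit_intervals (F := F) (f := fun q ↦ -f q) (t := -f p)
    (β := 0) (fun s hs hs' ↦ by
      obtain ⟨q, hq, hq1, hq2⟩ := hF (-(s + 1)) (by linarith) (by linarith)
      exact ⟨q, hq, by linarith, by linarith⟩) (k := i) (hi.imp_right fun h ↦ by linarith)
  simp only [neg_lt_neg_iff] at hdown
  have hdisj : Disjoint (F.filter fun q ↦ f q < f p) (F.filter fun q ↦ f p < f q) :=
    Finset.disjoint_filter.2 fun q _ h h' ↦ h.not_gt h'
  have hlt : ((F.filter fun q ↦ f q < f p).disjUnion _ hdisj).card < F.card := by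
    refine Finset.card_lt_card
      ((Finset.ssubset_iff_of_subset fun q hq ↦ ?_).2 ⟨p, hp, by simp⟩)
    simp only [Finset.mem_disjUnion, Finset.mem_filter] at hq
    exact hq.elim And.left And.left
  rw [Finset.card_disjUnion] at hlt
  omega

end Counting

/-- The cells `[i + x, i + 1] × [j + y, j + 1]`, stretched by `w` and `h`. -/
def cell (x y w h : ℝ) (i j : ℕ) : Set Plane :=
  closedBox ((i + x) * w) ((j + y) * h) ((1 - x) * w) ((1 - y) * h)

/-- Weight `1 / n` on the cells, `1 / (n + 1)` on the rest of a box of size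
`(n + x) w × (n + y) h`. -/
noncomputable def cellWeight (n : ℕ) (x y w h : ℝ) (p : Plane) : ℝ≥0∞ :=
  ENNReal.ofReal (n + 1 : ℝ)⁻¹ * (closedBox 0 0 ((n + x) * w) ((n + y) * h)).indicator 1 p +
    ENNReal.ofReal (n * (n + 1) : ℝ)⁻¹ *
      ∑ i ∈ Finset.range n, ∑ j ∈ Finset.range n, (cell x y w h i j).indicator 1 p

section CellWeight

variable {n : ℕ} {x y w h : ℝ}

theorem measurable_cellWeight : Measurable (cellWeight n x y w h) := by
  refine ((measurable_one.indicator (measurableSet_closedBox _ _ _ _)).const_mul _).add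
    (Measurable.const_mul (Finset.measurable_fun_sum _ fun i _ ↦
      Finset.measurable_fun_sum _ fun j _ ↦
        measurable_one.indicator (measurableSet_closedBox _ _ _ _)) _)

/-- Up to the factor `w h`, the box contributes `(n + x)(n + y) / (n + 1)` and the `n ^ 2` cells
contribute `n (1 - x)(1 - y) / (n + 1)`; the terms linear in `x` and `y` cancel in the sum. -/
theorem lintegral_cellWeight (hn : 0 < n) (hx : 0 < x) (hx1 : x < 1) (hy : 0 < y) (hy1 : y < 1)
    (hw : 0 < w) (hh : 0 < h) :
    ∫⁻ p, cellWeight n x y w h p = ENNReal.ofReal (w * h * (n + x * y)) := by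
  have hn' : (0 : ℝ) < n := by exact_mod_cast hn
  have hx' := sub_pos.2 hx1
  have hy' := sub_pos.2 hy1
  have hcell : ∀ i j, ∫⁻ p, (cell x y w h i j).indicator 1 p =
      ENNReal.ofReal ((1 - x) * w * ((1 - y) * h)) := fun i j ↦ by
    rw [cell, lintegral_indicator_one (measurableSet_closedBox _ _ _ _),
      volume_closedBox _ _ (by positivity)]
  have hm : ∀ i j, Measurable ((cell x y w h i j).indicator (1 : Plane → ℝ≥0∞)) := fun i j ↦
    measurable_one.indicator (measurableSet_closedBox _ _ _ _)
  unfold cellWeight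
  rw [lintegral_add_left ((measurable_one.indicator (measurableSet_closedBox _ _ _ _)).const_mul _),
    lintegral_const_mul _ (measurable_one.indicator (measurableSet_closedBox _ _ _ _)),
    lintegral_const_mul _ (Finset.measurable_fun_sum _ fun i _ ↦
      Finset.measurable_fun_sum _ fun j _ ↦ hm i j),
    lintegral_finsetSum _ (fun i _ ↦ Finset.measurable_fun_sum _ fun j _ ↦ hm i j),
    lintegral_indicator_one (measurableSet_closedBox _ _ _ _),
    volume_closedBox _ _ (by positivity)]
  simp only [lintegral_finsetSum _ fun j _ ↦ hm _ j, hcell, Finset.sum_const, Finset.card_range,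
    nsmul_eq_mul]
  rw [← ENNReal.ofReal_natCast n, ← ENNReal.ofReal_mul (by positivity),
    ← ENNReal.ofReal_mul (by positivity), ← ENNReal.ofReal_mul (by positivity),
    ← ENNReal.ofReal_mul (by positivity), ← ENNReal.ofReal_add (by positivity) (by positivity)]
  congr 1
  field_simp
  ring

theorem cell_subset (hx : 0 < x) (hy : 0 < y) (hw : 0 < w) (hh : 0 < h) {i j : ℕ}
    (hi : i < n) (hj : j < n) :
    cell x y w h i j ⊆ closedBox 0 0 ((n + x) * w) ((n + y) * h) := by
  rintro p ⟨⟨h1, h2⟩, h3, h4⟩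
  have hi' : (i : ℝ) + 1 ≤ n := by exact_mod_cast hi
  have hj' : (j : ℝ) + 1 ≤ n := by exact_mod_cast hj
  refine ⟨⟨h1.trans' (by positivity), h2.trans ?_⟩, h3.trans' (by positivity), h4.trans ?_⟩
  · nlinarith
  · nlinarith

theorem cellWeight_eq_zero (hx : 0 < x) (hy : 0 < y) (hw : 0 < w) (hh : 0 < h) {p : Plane}
    (hp : p ∉ closedBox 0 0 ((n + x) * w) ((n + y) * h)) : cellWeight n x y w h p = 0 := by
  rw [cellWeight, Set.indicator_of_notMem hp, mul_zero, zero_add,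
    Finset.sum_eq_zero fun i hi ↦ Finset.sum_eq_zero fun j hj ↦ Set.indicator_of_notMem
      (fun hmem ↦ hp (cell_subset hx hy hw hh (Finset.mem_range.1 hi) (Finset.mem_range.1 hj) hmem))
      _, mul_zero]

theorem le_cellWeight {p : Plane} (hp : p ∈ closedBox 0 0 ((n + x) * w) ((n + y) * h)) :
    ENNReal.ofReal (n + 1 : ℝ)⁻¹ ≤ cellWeight n x y w h p := by
  rw [cellWeight, Set.indicator_of_mem hp, Pi.one_apply, mul_one]
  exact le_self_add

theorem le_cellWeight_of_mem_cell (hn : 0 < n) {p : Plane}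
    (hp : p ∈ closedBox 0 0 ((n + x) * w) ((n + y) * h)) {i j : ℕ} (hi : i < n) (hj : j < n)
    (hpc : p ∈ cell x y w h i j) : ENNReal.ofReal (n : ℝ)⁻¹ ≤ cellWeight n x y w h p := by
  have hn' : (0 : ℝ) < n := by exact_mod_cast hn
  have h1 : (1 : ℝ≥0∞) ≤
      ∑ i ∈ Finset.range n, ∑ j ∈ Finset.range n, (cell x y w h i j).indicator 1 p := by
    calc (1 : ℝ≥0∞) = (cell x y w h i j).indicator 1 p := by simp [hpc]
      _ ≤ ∑ j ∈ Finset.range n, (cell x y w h i j).indicator 1 p :=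
        Finset.single_le_sum (f := fun j ↦ (cell x y w h i j).indicator (1 : Plane → ℝ≥0∞) p)
          (fun _ _ ↦ zero_le) (Finset.mem_range.2 hj)
      _ ≤ _ := Finset.single_le_sum
          (f := fun i ↦ ∑ j ∈ Finset.range n, (cell x y w h i j).indicator (1 : Plane → ℝ≥0∞) p)
          (fun _ _ ↦ zero_le) (Finset.mem_range.2 hi)
  rw [cellWeight, Set.indicator_of_mem hp, Pi.one_apply, mul_one]
  calc ENNReal.ofReal (n : ℝ)⁻¹
      = ENNReal.ofReal (n + 1 : ℝ)⁻¹ + ENNReal.ofReal (n * (n + 1) : ℝ)⁻¹ * 1 := by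
        rw [mul_one, ← ENNReal.ofReal_add (by positivity) (by positivity)]
        congr 1
        field_simp
    _ ≤ _ := by gcongr

/-- A set that meets all boxes of sizes `(n + x) w × h` and `w × (n + y) h` has lower density at
least `1 / (w h (n + x y))`. -/
theorem inv_le_lowerDensity_of_meetsBoxes (hn : 0 < n) (hx : 0 < x) (hx1 : x < 1) (hy : 0 < y)
    (hy1 : y < 1) (hw : 0 < w) (hh : 0 < h) {P : Set Plane} (hP₁ : MeetsBoxes P ((n + x) * w) h)
    (hP₂ : MeetsBoxes P w ((n + y) * h)) :
    ENNReal.ofReal (w * h * (n + x * y))⁻¹ ≤ lowerDensity P := by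
  have hn' : (0 : ℝ) < n := by exact_mod_cast hn
  rw [ENNReal.ofReal_inv_of_pos (by positivity),
    ← lintegral_cellWeight hn hx hx1 hy hy1 hw hh]
  refine inv_lintegral_le_lowerDensity (ρ := (n + x) * w + (n + y) * h) measurable_cellWeight
    (fun p hp ↦ cellWeight_eq_zero hx hy hw hh fun hmem ↦ hp.not_ge
      (norm_le_of_mem_closedBox hmem le_rfl le_rfl (by simp) (by simp))) fun z F _ hF ↦ ?_
  classical
  set Q := closedBox 0 0 ((n + x) * w) ((n + y) * h) with hQ
  have hpos : 0 < ENNReal.ofReal (n + 1 : ℝ)⁻¹ := by rw [ENNReal.ofReal_pos]; positivity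
  set G := F.filter fun p ↦ p - z ∈ Q with hG
  have hPG : ∀ p ∈ P, p - z ∈ Q → p ∈ G := fun p hp hpQ ↦
    Finset.mem_filter.2 ⟨hF p hp (hpos.trans_le (le_cellWeight hpQ)).ne', hpQ⟩
  have hGQ : ∀ p ∈ G, p - z ∈ Q := fun p hp ↦ (Finset.mem_filter.1 hp).2
  let f : Plane → ℝ := fun p ↦ (p 0 - z 0) / w
  let g : Plane → ℝ := fun p ↦ (p 1 - z 1) / h
  -- A vertical strip of `Q` of width `w` is a translate of the tall box, so it contains a point;
  -- `hg` does the same for horizontal strips and the wide box.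
  have hf : ∀ s, 0 ≤ s → s + 1 ≤ n + x → ∃ p ∈ G, f p ∈ Set.Icc s (s + 1) := by
    intro s hs hs'
    obtain ⟨p, hp, ⟨h1, h2⟩, h3, h4⟩ := hP₂ (z 0 + s * w) (z 1)
    have h5 : s ≤ f p := by rw [le_div_iff₀ hw]; linarith
    have h6 : f p ≤ s + 1 := by rw [div_le_iff₀ hw]; linarith
    refine ⟨p, hPG p hp ⟨⟨?_, ?_⟩, ?_, ?_⟩, h5, h6⟩ <;> simp only [PiLp.sub_apply, zero_add]
    · nlinarith
    · nlinarith
    · linarith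
    · linarith
  have hg : ∀ s, 0 ≤ s → s + 1 ≤ n + y → ∃ p ∈ G, g p ∈ Set.Icc s (s + 1) := by
    intro s hs hs'
    obtain ⟨p, hp, ⟨h1, h2⟩, h3, h4⟩ := hP₁ (z 0) (z 1 + s * h)
    have h5 : s ≤ g p := by rw [le_div_iff₀ hh]; linarith
    have h6 : g p ≤ s + 1 := by rw [div_le_iff₀ hh]; linarith
    refine ⟨p, hPG p hp ⟨⟨?_, ?_⟩, ?_, ?_⟩, h5, h6⟩ <;> simp only [PiLp.sub_apply, zero_add]
    · linarith
    · linarith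
    · nlinarith
    · nlinarith
  refine le_trans ?_ (Finset.sum_le_sum_of_subset (Finset.filter_subset _ F : G ⊆ F))
  -- Either `Q` holds at least `n + 1` points, each of weight at least `1 / (n + 1)`, or exactly
  -- `n`. In the latter case a coordinate in a gap would force another point, so all points lie in
  -- cells, where the weight is at least `1 / n`.
  rcases (le_card_of_meets_unit_intervals hx hf).lt_or_eq with hcard | hcard
  · calc (1 : ℝ≥0∞) = (n + 1 : ℕ) * ENNReal.ofReal (n + 1 : ℝ)⁻¹ := by
          rw [← ENNReal.ofReal_natCast, ← ENNReal.ofReal_mul (by positivity)]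
          push_cast
          rw [mul_inv_cancel₀ (by positivity), ENNReal.ofReal_one]
      _ ≤ G.card * ENNReal.ofReal (n + 1 : ℝ)⁻¹ := by gcongr; exact hcard
      _ = ∑ p ∈ G, ENNReal.ofReal (n + 1 : ℝ)⁻¹ := by simp
      _ ≤ _ := Finset.sum_le_sum fun p hp ↦ le_cellWeight (hGQ p hp)
  · have hgood : ∀ p ∈ G, ∃ i < n, ∃ j < n, p - z ∈ cell x y w h i j := by
      intro p hp
      obtain ⟨⟨h1, h2⟩, h3, h4⟩ := hGQ p hp
      simp only [PiLp.sub_apply, zero_add] at h1 h2 h3 h4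
      have hi : ∃ i < n, i + x ≤ f p ∧ f p ≤ i + 1 := by
        by_contra! hcon
        refine (lt_card_of_meets_unit_intervals hf hp (div_nonneg h1 hw.le)
          ((div_le_iff₀ hw).2 h2) hx hx1 fun i hi hi' ↦ ?_).ne hcard
        exact (hcon i hi hi'.1).not_ge hi'.2
      have hj : ∃ j < n, j + y ≤ g p ∧ g p ≤ j + 1 := by
        by_contra! hcon
        refine (lt_card_of_meets_unit_intervals hg hp (div_nonneg h3 hh.le)
          ((div_le_iff₀ hh).2 h4) hy hy1 fun j hj hj' ↦ ?_).ne hcard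
        exact (hcon j hj hj'.1).not_ge hj'.2
      obtain ⟨i, hi, hi1, hi2⟩ := hi
      obtain ⟨j, hj, hj1, hj2⟩ := hj
      refine ⟨i, hi, j, hj, ⟨?_, ?_⟩, ?_, ?_⟩ <;> simp only [PiLp.sub_apply]
      · exact (le_div_iff₀ hw).1 hi1
      · linarith [(div_le_iff₀ hw).1 hi2]
      · exact (le_div_iff₀ hh).1 hj1
      · linarith [(div_le_iff₀ hh).1 hj2]
    calc (1 : ℝ≥0∞) = n * ENNReal.ofReal (n : ℝ)⁻¹ := by
          rw [← ENNReal.ofReal_natCast, ← ENNReal.ofReal_mul (by positivity),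
            mul_inv_cancel₀ (by positivity), ENNReal.ofReal_one]
      _ = ∑ p ∈ G, ENNReal.ofReal (n : ℝ)⁻¹ := by simp [← hcard]
      _ ≤ _ := Finset.sum_le_sum fun p hp ↦ by
        obtain ⟨i, hi, j, hj, hc⟩ := hgood p hp
        exact le_cellWeight_of_mem_cell hn (hGQ p hp) hi hj hc

end CellWeight

/-! ### Boxes met by lattices -/

/-- Every closed box of size `W × H` contains an integer combination of `(u₀, u₁)` and
`(v₀, v₁)`. -/
def LatticeMeets (u₀ u₁ v₀ v₁ W H : ℝ) : Prop :=
  ∀ x y : ℝ, ∃ i j : ℤ, i * u₀ + j * v₀ ∈ Set.Icc x (x + W) ∧ i * u₁ + j * v₁ ∈ Set.Icc y (y + H)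

namespace LatticeMeets

variable {u₀ u₁ v₀ v₁ W H : ℝ}

theorem swap (h : LatticeMeets u₀ u₁ v₀ v₁ W H) : LatticeMeets u₁ u₀ v₁ v₀ H W := fun x y ↦ by
  obtain ⟨i, j, h1, h2⟩ := h y x
  exact ⟨i, j, h2, h1⟩

theorem symm (h : LatticeMeets u₀ u₁ v₀ v₁ W H) : LatticeMeets v₀ v₁ u₀ u₁ W H := fun x y ↦ by
  obtain ⟨i, j, h1, h2⟩ := h x y
  exact ⟨j, i, by rwa [add_comm (j * v₀)], by rwa [add_comm (j * v₁)]⟩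

theorem mono (h : LatticeMeets u₀ u₁ v₀ v₁ W H) {W' H' : ℝ} (hW : W ≤ W') (hH : H ≤ H') :
    LatticeMeets u₀ u₁ v₀ v₁ W' H' := fun x y ↦ by
  obtain ⟨i, j, ⟨h1, h2⟩, h3, h4⟩ := h x y
  exact ⟨i, j, ⟨h1, by linarith⟩, h3, by linarith⟩

/-- A lattice meets the boxes that are met by a sublattice. -/
theorem of_sublattice {u₀' u₁' v₀' v₁' : ℝ} (h : LatticeMeets u₀' u₁' v₀' v₁' W H)
    (a b c d : ℤ) (hu₀ : u₀' = a * u₀ + b * v₀) (hu₁ : u₁' = a * u₁ + b * v₁)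
    (hv₀ : v₀' = c * u₀ + d * v₀) (hv₁ : v₁' = c * u₁ + d * v₁) :
    LatticeMeets u₀ u₁ v₀ v₁ W H := fun x y ↦ by
  obtain ⟨i, j, h1, h2⟩ := h x y
  refine ⟨i * a + j * c, i * b + j * d, ?_, ?_⟩
  · convert h1 using 1
    rw [hu₀, hv₀]; push_cast; ring
  · convert h2 using 1
    rw [hu₁, hv₁]; push_cast; ring

theorem scale (hm : LatticeMeets u₀ u₁ v₀ v₁ W H) {w h : ℝ} (hw : 0 < w) (hh : 0 < h) :
    LatticeMeets (w * u₀) (h * u₁) (w * v₀) (h * v₁) (W * w) (H * h) := fun x y ↦ by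
  obtain ⟨i, j, ⟨h1, h2⟩, h3, h4⟩ := hm (x / w) (y / h)
  rw [div_le_iff₀ hw] at h1
  rw [div_add' _ _ _ hw.ne', le_div_iff₀ hw] at h2
  rw [div_le_iff₀ hh] at h3
  rw [div_add' _ _ _ hh.ne', le_div_iff₀ hh] at h4
  exact ⟨i, j, ⟨by linarith, by linarith⟩, by linarith, by linarith⟩

/-- In a horizontal strip of height `q + s`, the points of the lattice spanned by `(p, -q)` and
`(r, s)` follow each other in steps `(p, -q)` and `(r, s)`. -/
theorem of_max_add {p q r s : ℝ} (hp : 0 < p) (hr : 0 < r) (hq : 0 ≤ q) (hs : 0 ≤ s)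
    (hqs : 0 < q + s) : LatticeMeets p (-q) r s (max p r) (q + s) := fun x y ↦ by
  -- With coefficients `k - j` and `j` the height is `j (q + s) - k q`; `j k` is the least `j`
  -- bringing it up to `y`. Since `0 ≤ q ≤ q + s`, it grows by `0` or `1` with `k`.
  let j : ℤ → ℤ := fun k ↦ ⌈(y + k * q) / (q + s)⌉
  let X : ℤ → ℝ := fun k ↦ ((k - j k : ℤ) : ℝ) * p + j k * r
  have hj : ∀ k, j (k + 1) = j k ∨ j (k + 1) = j k + 1 := by
    intro k
    have h1 : j k ≤ j (k + 1) := by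
      refine Int.ceil_le_ceil (div_le_div_of_nonneg_right ?_ hqs.le)
      push_cast
      linarith
    have h2 : j (k + 1) ≤ j k + 1 := by
      rw [← Int.ceil_add_one]
      refine Int.ceil_le_ceil ?_
      rw [div_add_one hqs.ne']
      refine div_le_div_of_nonneg_right ?_ hqs.le
      push_cast
      linarith
    omega
  have hstep : ∀ k, X (k + 1) = X k + p ∨ X (k + 1) = X k + r := by
    intro k
    rcases hj k with h | h
    · left; simp only [X, h]; push_cast; ring
    · right; simp only [X, h]; push_cast; ring
  have hstep1 : ∀ k, X k + min p r ≤ X (k + 1) := fun k ↦ by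
    rcases hstep k with h | h <;> rw [h] <;> gcongr
    · exact min_le_left _ _
    · exact min_le_right _ _
  have hstep2 : ∀ k, X (k + 1) ≤ X k + max p r := fun k ↦ by
    rcases hstep k with h | h <;> rw [h] <;> gcongr
    · exact le_max_left _ _
    · exact le_max_right _ _
  have hm : 0 < min p r := lt_min hp hr
  have hup : ∀ n : ℕ, X 0 + n * min p r ≤ X n := fun n ↦ by
    induction n with
    | zero => simp
    | succ n ih => have := hstep1 n; push_cast at *; linarith
  have hdown : ∀ n : ℕ, X (-n) ≤ X 0 - n * min p r := fun n ↦ by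
    induction n with
    | zero => simp
    | succ n ih =>
      have := hstep1 (-(n + 1 : ℤ))
      rw [show -(n + 1 : ℤ) + 1 = -n by ring] at this
      push_cast at *; linarith
  have hmono : Monotone X := monotone_int_of_le_succ fun k ↦ by linarith [hstep1 k]
  -- The last point of the path not beyond the right side of the box; as its successor lies beyond,
  -- it cannot be left of `x`.
  obtain ⟨k, hk, hmax⟩ := Int.exists_greatest_of_bdd (P := fun k ↦ X k ≤ x + max p r) (by
      obtain ⟨n, hn⟩ := exists_nat_gt ((x + max p r - X 0) / min p r)
      rw [div_lt_iff₀ hm] at hn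
      refine ⟨n, fun z hz ↦ not_lt.1 fun hlt ↦ ?_⟩
      linarith [hmono hlt.le, hup n]) (by
      obtain ⟨n, hn⟩ := exists_nat_gt ((X 0 - (x + max p r)) / min p r)
      rw [div_lt_iff₀ hm] at hn
      exact ⟨-n, by linarith [hdown n]⟩)
  have hk' : x + max p r < X (k + 1) := not_le.1 fun h ↦ by linarith [hmax _ h]
  refine ⟨k - j k, j k, ⟨by linarith [hstep2 k], hk⟩, ?_, ?_⟩
  · have := Int.le_ceil ((y + k * q) / (q + s))
    rw [div_le_iff₀ hqs] at this
    push_cast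
    linarith
  · have := Int.ceil_lt_add_one ((y + k * q) / (q + s))
    rw [div_add_one hqs.ne', lt_div_iff₀ hqs] at this
    push_cast
    linarith

theorem of_add_max {p q r s : ℝ} (hq : 0 < q) (hs : 0 < s) (hp : 0 ≤ p) (hr : 0 ≤ r)
    (hpr : 0 < p + r) : LatticeMeets p (-q) r s (p + r) (max q s) :=
  (of_max_add hq hs hp hr hpr).swap.of_sublattice (-1) 0 0 1 (by simp) (by simp) (by simp)
    (by simp)

/-- The lattice of rows with offset `c / m` meets the boxes of sizes `c × 1` and `1 × m`. -/
theorem rows {c : ℝ} {m : ℕ} (hm : 0 < m) (hc : 0 < c) (hcm : c ≤ m) :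
    LatticeMeets c 0 (c / m) 1 c 1 ∧ LatticeMeets c 0 (c / m) 1 1 m := by
  have hm' : (1 : ℝ) ≤ m := by exact_mod_cast hm
  have hm0 : (m : ℝ) ≠ 0 := by positivity
  have hcm' : c / m ≤ c := div_le_self hc.le hm'
  constructor
  -- With `u = (c, 0)` and `v = (c / m, 1)`, the basis `u - v, v` serves the wide box, and `u + (1 -
  -- m) v, v` the tall one.
  · refine ((of_add_max (p := c - c / m) (q := 1) (r := c / m) (s := 1) one_pos one_pos
      (by linarith) (by positivity) (by linarith)).of_sublattice 1 (-1) 0 1 ?_ ?_ ?_ ?_).mono ?_ ?_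
    all_goals simp
    ring
  · refine ((of_max_add (p := c / m) (q := m - 1) (r := c / m) (s := 1) (by positivity)
      (by positivity) (by linarith) one_pos.le (by linarith)).of_sublattice 1 (1 - m) 0 1
        ?_ ?_ ?_ ?_).mono ?_ ?_
    · push_cast; field_simp; ring
    · push_cast; ring
    · simp
    · simp
    · rw [max_self]; exact div_le_one_of_le₀ hcm (by positivity)
    · linarith

/-- Two bases of the same lattice are used. The given vectors `u, v` have horizontal steps at most
`1` and vertical extents adding up to `b`. The basis `u, (n - 1) u + v` has vertical steps `1` and
`b - n ≤ 1` and horizontal extents adding up to `a`. -/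
theorem skew {a b : ℝ} {n : ℕ} (hn : 0 < n) (ha : n < a) (ha' : a ≤ n + 1) (hb : n < b)
    (hb' : b ≤ n + 1) : LatticeMeets ((a - 1) / n) (-1) 1 (b - 1) a 1 ∧
      LatticeMeets ((a - 1) / n) (-1) 1 (b - 1) 1 b := by
  have hn' : (1 : ℝ) ≤ n := by exact_mod_cast hn
  have hn0 : (n : ℝ) ≠ 0 := by positivity
  have hp : 0 < (a - 1) / n := div_pos (by linarith) (by linarith)
  constructor
  · refine ((of_add_max (p := (a - 1) / n) (q := 1) (r := a - (a - 1) / n) (s := b - n) one_pos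
      (by linarith) hp.le ?_ (by linarith)).of_sublattice 1 0 (n - 1) 1 ?_ ?_ ?_ ?_).mono ?_ ?_
    · rw [sub_nonneg, div_le_iff₀ (by linarith)]; nlinarith
    · simp
    · simp
    · push_cast; field_simp; ring
    · push_cast; ring
    · linarith
    · exact max_le le_rfl (by linarith)
  · refine (of_max_add (p := (a - 1) / n) (q := 1) (r := 1) (s := b - 1) hp one_pos zero_le_one
      (by linarith) (by linarith)).mono (max_le ?_ le_rfl) (by linarith)
    rw [div_le_iff₀ (by linarith)]
    linarith

end LatticeMeets

/-! ### The approximation ratio -/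

/-- With `t = √(xy)`, the quantity `m` is at most `t ^ 2` and, by the AM-GM inequality, `n m ≤ (n -
1)(1 - t) ^ 2`. For `n = 1` this gives `m ≤ 0`. For `n = 2` the two bounds balance at `t = √2 - 1`,
which is where the constant comes from. For `n ≥ 3` the bound `m ≤ 1 / 4` suffices. -/
theorem ratio_bound {n : ℕ} (hn : 0 < n) {x y m : ℝ} (hx : 0 < x) (hx1 : x < 1) (hy : 0 < y)
    (hy1 : y < 1) (hm : m ≤ x * y) (hm' : n * m ≤ (n - 1) * ((1 - x) * (1 - y))) :
    m ≤ (3 / 2 - Real.sqrt 2) * n := by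
  have h2 : Real.sqrt 2 ^ 2 = 2 := Real.sq_sqrt zero_le_two
  have h20 : 0 ≤ Real.sqrt 2 := Real.sqrt_nonneg 2
  have h2lt : Real.sqrt 2 < 1.4143 := by
    rw [Real.sqrt_lt' (by norm_num)]; norm_num
  have h2gt : 1.4142 < Real.sqrt 2 := by
    rw [Real.lt_sqrt (by norm_num)]; norm_num
  obtain ⟨t, ht, htxy⟩ : ∃ t, 0 < t ∧ t ^ 2 = x * y :=
    ⟨Real.sqrt (x * y), Real.sqrt_pos.2 (by positivity), Real.sq_sqrt (by positivity)⟩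
  have ht1 : t < 1 := by nlinarith
  have hxy : 2 * t ≤ x + y := by nlinarith [sq_nonneg (x - y)]
  have hle : (1 - x) * (1 - y) ≤ (1 - t) ^ 2 := by nlinarith
  rcases (show n = 1 ∨ n = 2 ∨ 3 ≤ n by omega) with rfl | rfl | h
  · push_cast at *
    linarith
  · by_contra! hcon
    push_cast at *
    have h3 : (Real.sqrt 2 - 1) ^ 2 < t ^ 2 := by nlinarith
    have h4 : Real.sqrt 2 - 1 < t := lt_of_pow_lt_pow_left₀ 2 ht.le h3
    have h5 : (1 - t) ^ 2 < (2 - Real.sqrt 2) ^ 2 :=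
      pow_lt_pow_left₀ (by linarith) (by linarith) two_ne_zero
    nlinarith
  · have h3 : (3 : ℝ) ≤ n := by exact_mod_cast h
    have h4 : m ≤ (1 - t) ^ 2 := by
      rcases le_or_gt m 0 with h0 | h0
      · exact h0.trans (sq_nonneg _)
      · have : (n - 1) * ((1 - x) * (1 - y)) ≤ n * (1 - t) ^ 2 := by
          have h7 : 0 ≤ (1 - x) * (1 - y) := mul_nonneg (by linarith) (by linarith)
          nlinarith
        exact le_of_mul_le_mul_left (hm'.trans this) (by linarith)
    have h5 : m ≤ 1 / 4 := by
      rcases le_total t (1 / 2) with h6 | h6 <;> nlinarith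
    nlinarith

theorem le_ratio_mul {n : ℕ} (hn : 0 < n) {x y : ℝ} (hx : 0 < x) (hx1 : x < 1) (hy : 0 < y)
    (hy1 : y < 1) : n + x * y ≤
      (5 / 2 - Real.sqrt 2) * max (n : ℝ) (1 + (n - 1 + x) * (n - 1 + y) / n) := by
  have hn' : (0 : ℝ) < n := by exact_mod_cast hn
  -- The determinants `n` and `n + x y - e` fall short of `n + x y` by `x y` and `e`; the smaller
  -- deficit is what `ratio_bound` controls.
  obtain ⟨e, he⟩ : ∃ e, e = (n - 1) * ((1 - x) * (1 - y)) / n := ⟨_, rfl⟩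
  have hne : n * e = (n - 1) * ((1 - x) * (1 - y)) := by rw [he]; field_simp
  have hD : 1 + (n - 1 + x) * (n - 1 + y) / n = n + x * y - e := by
    rw [he]; field_simp; ring
  have h2lt : Real.sqrt 2 < 1.4143 := by
    rw [Real.sqrt_lt' (by norm_num)]; norm_num
  rw [hD]
  rcases le_total (x * y) e with h | h
  · have := ratio_bound hn hx hx1 hy hy1 le_rfl (by rw [← hne]; gcongr)
    rw [max_eq_left (by linarith)]
    linarith
  · have := ratio_bound hn hx hx1 hy hy1 h hne.le
    rw [max_eq_right (by linarith)]
    nlinarith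

/-! ### Piercing and boxes -/

theorem MeetsBoxes.mono {P : Set Plane} {W H W' H' : ℝ} (h : MeetsBoxes P W H) (hW : W ≤ W')
    (hH : H ≤ H') : MeetsBoxes P W' H' := fun x y ↦ by
  obtain ⟨p, hp, ⟨h1, h2⟩, h3, h4⟩ := h x y
  exact ⟨p, hp, ⟨h1, by linarith⟩, h3, by linarith⟩

theorem meetsBoxes_iff_forall_vadd {P : Set Plane} {R : AxisRect} :
    MeetsBoxes P (R.x₂ - R.x₁) (R.y₂ - R.y₁) ↔ ∀ x : Plane, ∃ p ∈ P, p ∈ x +ᵥ R.toSet := by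
  have key : ∀ x p : Plane, p ∈ x +ᵥ R.toSet ↔
      p ∈ closedBox (x 0 + R.x₁) (x 1 + R.y₁) (R.x₂ - R.x₁) (R.y₂ - R.y₁) := by
    intro x p
    rw [Set.mem_vadd_set_iff_neg_vadd_mem]
    simp only [AxisRect.toSet, closedBox, Set.mem_Icc, Set.mem_ofPred_eq, vadd_eq_add,
      PiLp.add_apply, PiLp.neg_apply]
    constructor <;> rintro ⟨⟨h1, h2⟩, h3, h4⟩ <;> refine ⟨⟨?_, ?_⟩, ?_, ?_⟩ <;> linarith
  simp only [key]
  refine ⟨fun h x ↦ h _ _, fun h x y ↦ ?_⟩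
  simpa using h !₂[x - R.x₁, y - R.y₁]

theorem isPiercing_pair_iff {P : Set Plane} {R₁ R₂ : AxisRect} :
    IsPiercing {R₁.toSet, R₂.toSet} P ↔
      MeetsBoxes P (R₁.x₂ - R₁.x₁) (R₁.y₂ - R₁.y₁) ∧
        MeetsBoxes P (R₂.x₂ - R₂.x₁) (R₂.y₂ - R₂.y₁) := by
  simp [IsPiercing, meetsBoxes_iff_forall_vadd]

theorem LatticeMeets.meetsBoxes {u₀ u₁ v₀ v₁ W H : ℝ} (h : LatticeMeets u₀ u₁ v₀ v₁ W H) :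
    MeetsBoxes (latticePoints !₂[u₀, u₁] !₂[v₀, v₁]) W H := fun x y ↦ by
  obtain ⟨i, j, h1, h2⟩ := h x y
  refine ⟨_, mem_latticePoints.2 ⟨i, j, rfl⟩, ?_, ?_⟩
  · simpa using h1
  · simpa using h2

theorem one_le_ratio : (1 : ℝ) ≤ 5 / 2 - Real.sqrt 2 := by
  have : Real.sqrt 2 ≤ 1.5 := by
    rw [Real.sqrt_le_left (by norm_num)]; norm_num
  linarith

theorem ofReal_inv_le_ratio_mul {A D c : ℝ} {L : ℝ≥0∞} (hA : 0 < A) (hD : 0 < D) (hc : 0 ≤ c)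
    (h : A ≤ c * D) (hL : ENNReal.ofReal A⁻¹ ≤ L) :
    ENNReal.ofReal D⁻¹ ≤ ENNReal.ofReal c * L := by
  calc ENNReal.ofReal D⁻¹ ≤ ENNReal.ofReal (c * A⁻¹) := by
        refine ENNReal.ofReal_le_ofReal ?_
        rw [← div_eq_mul_inv, le_div_iff₀ hA, inv_mul_le_iff₀ hD]
        linarith
    _ = ENNReal.ofReal c * ENNReal.ofReal A⁻¹ := ENNReal.ofReal_mul hc
    _ ≤ _ := by gcongr

/-! ### The algorithm -/

namespace TwoRectangles

open RealRAM RealRAM.Expr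

def width₁ : Expr := .sub (.var 1) (.var 0)
def height₁ : Expr := .sub (.var 3) (.var 2)
def width₂ : Expr := .sub (.var 5) (.var 4)
def height₂ : Expr := .sub (.var 7) (.var 6)
def minWidth : Expr := .ite width₁ width₂ width₁ width₂
def minHeight : Expr := .ite height₁ height₂ height₁ height₂

/-- Ratio of the two widths, or `1` if one of the rectangles dominates the other. -/
def relWidth : Expr :=
  .ite width₁ width₂ (.ite height₁ height₂ (.const 1) (.div width₂ width₁))
    (.ite height₂ height₁ (.const 1) (.div width₁ width₂))

/-- Ratio of the two heights, or `1` if one of the rectangles dominates the other. -/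
def relHeight : Expr :=
  .ite width₁ width₂ (.ite height₁ height₂ (.const 1) (.div height₁ height₂))
    (.ite height₂ height₁ (.const 1) (.div height₂ height₁))

/-- Determinant of the skew lattice of `LatticeMeets.skew`. -/
def skewDet : Expr :=
  .add (.const 1)
    (.div (.mul (.sub relWidth (.const 1)) (.sub relHeight (.const 1))) (.floor relWidth))

/-- Case distinction between a lattice of rows, a lattice of columns, a lattice of rows with an
integral determinant, and a skew lattice. -/
def choose (rows cols integral skew : Expr) : Expr :=
  .ite relWidth (.floor relHeight) rows
    (.ite relHeight (.floor relWidth) cols (.ite skewDet (.floor relWidth) integral skew))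

def relBasis₀ : Expr :=
  choose relWidth (.const 1) (.floor relWidth)
    (.div (.sub relWidth (.const 1)) (.floor relWidth))
def relBasis₁ : Expr :=
  choose (.const 0) (.div relHeight (.floor relWidth)) (.const 0) (.const (-1))
def relBasis₂ : Expr :=
  choose (.div relWidth (.floor relHeight)) (.const 0) (.const 1) (.const 1)
def relBasis₃ : Expr :=
  choose (.const 1) relHeight (.const 1) (.sub relHeight (.const 1))

def basis₀ : Expr := .mul minWidth relBasis₀
def basis₁ : Expr := .mul minHeight relBasis₁
def basis₂ : Expr := .mul minWidth relBasis₂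
def basis₃ : Expr := .mul minHeight relBasis₃

def density : Expr :=
  .div (.const 1) (.sub (.mul basis₀ basis₃) (.mul basis₁ basis₂))

/-- The registers hold the coordinates of two nondegenerate rectangles. -/
def ValidInput (env : ℕ → ℝ) : Prop :=
  0 < width₁.eval env ∧ 0 < height₁.eval env ∧ 0 < width₂.eval env ∧ 0 < height₂.eval env

variable {env : ℕ → ℝ}

theorem minWidth_pos (h : ValidInput env) : 0 < minWidth.eval env := by
  simp only [minWidth, eval]
  split_ifs
  exacts [h.1, h.2.2.1]

theorem minHeight_pos (h : ValidInput env) : 0 < minHeight.eval env := by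
  simp only [minHeight, eval]
  split_ifs
  exacts [h.2.1, h.2.2.2]

theorem one_le_relWidth (h : ValidInput env) : 1 ≤ relWidth.eval env := by
  obtain ⟨h1, h2, h3, h4⟩ := h
  simp only [relWidth, eval, Int.cast_one]
  split_ifs with h5 h6 h6
  · exact le_rfl
  · exact (one_le_div h1).2 h5
  · exact le_rfl
  · exact (one_le_div h3).2 (le_of_not_ge h5)

theorem one_le_relHeight (h : ValidInput env) : 1 ≤ relHeight.eval env := by
  obtain ⟨h1, h2, h3, h4⟩ := h
  simp only [relHeight, eval, Int.cast_one]
  split_ifs with h5 h6 h6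
  · exact le_rfl
  · exact (one_le_div h4).2 (le_of_not_ge h6)
  · exact le_rfl
  · exact (one_le_div h2).2 (le_of_not_ge h6)

/-- If one rectangle fits into the other, both relative sizes are `1` and the right side speaks of
the smaller rectangle twice; otherwise it lists the wide and the tall rectangle. -/
theorem meetsBoxes_iff (h : ValidInput env) {P : Set Plane} :
    MeetsBoxes P (width₁.eval env) (height₁.eval env) ∧
        MeetsBoxes P (width₂.eval env) (height₂.eval env) ↔
      MeetsBoxes P (relWidth.eval env * minWidth.eval env) (minHeight.eval env) ∧
        MeetsBoxes P (minWidth.eval env) (relHeight.eval env * minHeight.eval env) := by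
  obtain ⟨h1, h2, h3, h4⟩ := h
  simp only [relWidth, relHeight, minWidth, minHeight]
  rw [eval, eval, eval, eval, eval, eval, eval, eval]
  generalize hw₁ : width₁.eval env = w₁ at *
  generalize hw₂ : width₂.eval env = w₂ at *
  generalize hh₁ : height₁.eval env = h₁ at *
  generalize hh₂ : height₂.eval env = h₂ at *
  simp only [eval, hw₁, hw₂, hh₁, hh₂, Int.cast_one]
  split_ifs with h5 h6 h6 h6 h7
  · simp only [one_mul, and_self, and_iff_left_iff_imp]
    exact fun h ↦ h.mono h5 h6
  · rw [div_mul_cancel₀ _ h1.ne', div_mul_cancel₀ _ h4.ne', and_comm]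
  · obtain rfl := le_antisymm ‹h₁ ≤ h₂› ‹h₂ ≤ h₁›
    simp only [one_mul, and_self, and_iff_right_iff_imp]
    exact fun h ↦ h.mono (le_of_not_ge h5) le_rfl
  · simp only [one_mul, and_self, and_iff_right_iff_imp]
    exact fun h ↦ h.mono (le_of_not_ge h5) ‹_›
  · rw [div_mul_cancel₀ _ h3.ne', div_mul_cancel₀ _ h2.ne']
  · exact absurd (le_of_not_ge ‹¬h₁ ≤ h₂›) ‹_›

theorem eval_choose (r c i s : Expr) : (choose r c i s).eval env =
    if relWidth.eval env ≤ ⌊relHeight.eval env⌋ then r.eval env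
    else if relHeight.eval env ≤ ⌊relWidth.eval env⌋ then c.eval env
    else if skewDet.eval env ≤ ⌊relWidth.eval env⌋ then i.eval env else s.eval env := by
  simp only [choose, eval]
  congr!

/-- Correctness of the case distinction in normalized coordinates: `D` is the determinant of the
chosen lattice and `A` the reciprocal of the density bound for piercing sets. For rows and columns
`A = D`, so these choices are optimal. -/
theorem relBasis_spec (hin : ValidInput env) :
    LatticeMeets (relBasis₀.eval env) (relBasis₁.eval env) (relBasis₂.eval env)
        (relBasis₃.eval env) (relWidth.eval env) 1 ∧
      LatticeMeets (relBasis₀.eval env) (relBasis₁.eval env) (relBasis₂.eval env)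
        (relBasis₃.eval env) 1 (relHeight.eval env) ∧
      ∃ D A : ℝ, 0 < D ∧ 0 < A ∧ A ≤ (5 / 2 - Real.sqrt 2) * D ∧
        relBasis₀.eval env * relBasis₃.eval env - relBasis₁.eval env * relBasis₂.eval env = D ∧
        ∀ (P : Set Plane) (w h : ℝ), 0 < w → 0 < h → MeetsBoxes P (relWidth.eval env * w) h →
          MeetsBoxes P w (relHeight.eval env * h) →
            ENNReal.ofReal (w * h * A)⁻¹ ≤ lowerDensity P := by
  have ha := one_le_relWidth hin
  have hb := one_le_relHeight hin
  have hs : skewDet.eval env = 1 + (relWidth.eval env - 1) * (relHeight.eval env - 1) /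
      ⌊relWidth.eval env⌋ := by simp [skewDet, eval]
  simp only [relBasis₀, relBasis₁, relBasis₂, relBasis₃, eval_choose]
  simp only [eval, hs]
  generalize relWidth.eval env = a at *
  generalize relHeight.eval env = b at *
  obtain ⟨n, hn⟩ : ∃ n : ℕ, ⌊a⌋ = n := Int.eq_ofNat_of_zero_le (Int.floor_nonneg.2 (by linarith))
  obtain ⟨m, hm⟩ : ∃ m : ℕ, ⌊b⌋ = m := Int.eq_ofNat_of_zero_le (Int.floor_nonneg.2 (by linarith))
  have hn1 : (n : ℝ) ≤ a := by simpa [hn] using Int.floor_le a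
  have hn2 : a < n + 1 := by simpa [hn] using Int.lt_floor_add_one a
  have hm1 : (m : ℝ) ≤ b := by simpa [hm] using Int.floor_le b
  have hm2 : b < m + 1 := by simpa [hm] using Int.lt_floor_add_one b
  have hn0 : 0 < n := by
    have : (0 : ℝ) < n := by linarith
    exact_mod_cast this
  have hm0 : 0 < m := by
    have : (0 : ℝ) < m := by linarith
    exact_mod_cast this
  simp only [hn, hm, Int.cast_natCast, Int.cast_one, Int.cast_zero, Int.cast_neg]
  split_ifs with h1 h2 h3
  · obtain ⟨r1, r2⟩ := LatticeMeets.rows hm0 (by linarith) h1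
    refine ⟨r1, r2.mono le_rfl hm1, a, a, by linarith, by linarith,
      le_mul_of_one_le_left (by linarith) one_le_ratio, by ring, fun P w h hw hh hP _ ↦ ?_⟩
    convert inv_area_le_lowerDensity (by positivity) hh hP using 3
    ring
  · obtain ⟨r1, r2⟩ := LatticeMeets.rows hn0 (by linarith) h2
    refine ⟨(r2.swap.symm).mono hn1 le_rfl, r1.swap.symm, b, b, by linarith, by linarith,
      le_mul_of_one_le_left (by linarith) one_le_ratio, by ring, fun P w h hw hh _ hP ↦ ?_⟩
    convert inv_area_le_lowerDensity hw (by positivity) hP using 3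
    ring
  all_goals
    -- If the integer parts differed, the ratio with the smaller one would be below the other
    -- integer part, which the first two tests exclude. The same tests make both fractional parts
    -- positive.
    obtain rfl : n = m := by
      rw [not_le] at h1 h2
      have e1 : (m : ℝ) < n + 1 := by linarith
      have e2 : (n : ℝ) < m + 1 := by linarith
      norm_cast at e1 e2
      omega
    rw [not_le] at h1 h2
    have hn' : (1 : ℝ) ≤ n := by exact_mod_cast hn0
    have hratio := le_ratio_mul hn0 (x := a - n) (y := b - n) (by linarith) (by linarith)
      (by linarith) (by linarith)
    rw [show 1 + (n - 1 + (a - n)) * (n - 1 + (b - n)) / n = 1 + (a - 1) * (b - 1) / n by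
      ring] at hratio
    have hxy : 0 < (a - n) * (b - n) := mul_pos (by linarith) (by linarith)
    have hlow : ∀ (P : Set Plane) (w h : ℝ), 0 < w → 0 < h → MeetsBoxes P (a * w) h →
        MeetsBoxes P w (b * h) →
          ENNReal.ofReal (w * h * (n + (a - n) * (b - n)))⁻¹ ≤ lowerDensity P :=
      fun P w h hw hh hP₁ hP₂ ↦ inv_le_lowerDensity_of_meetsBoxes hn0 (by linarith) (by linarith)
        (by linarith) (by linarith) hw hh (by simpa using hP₁) (by simpa using hP₂)
  · obtain ⟨r1, r2⟩ := LatticeMeets.rows hn0 (c := n) (by linarith) le_rfl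
    rw [div_self (by linarith)] at r1 r2
    rw [max_eq_left h3] at hratio
    exact ⟨r1.mono hn1 le_rfl, r2.mono le_rfl hm1, n, _, by linarith, by positivity, hratio,
      by ring, hlow⟩
  · obtain ⟨r1, r2⟩ := LatticeMeets.skew hn0 h1 hn2.le h2 hm2.le
    rw [max_eq_right (le_of_not_ge h3)] at hratio
    exact ⟨r1, r2, _, _, by linarith, by positivity, hratio, by ring, hlow⟩

/-- Definedness is required of every branch, even of those not taken; this is harmless because the
denominators are side lengths, positive whatever the comparisons say. -/
theorem defined_relWidth (h : ValidInput env) : relWidth.Defined 8 env := by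
  obtain ⟨h1, h2, h3, h4⟩ := h
  simp only [relWidth, Defined]
  simp [width₁, width₂, height₁, height₂, Defined] at h1 h3 ⊢
  exact ⟨h1.ne', h3.ne'⟩

theorem defined_relHeight (h : ValidInput env) : relHeight.Defined 8 env := by
  obtain ⟨h1, h2, h3, h4⟩ := h
  simp only [relHeight, Defined]
  simp [width₁, width₂, height₁, height₂, Defined] at h2 h4 ⊢
  exact ⟨h4.ne', h2.ne'⟩

theorem floor_relWidth_ne_zero (h : ValidInput env) : (Expr.floor relWidth).eval env ≠ 0 := by
  simp only [eval, ne_eq, Int.cast_eq_zero]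
  exact (Int.floor_pos.2 (one_le_relWidth h)).ne'

theorem floor_relHeight_ne_zero (h : ValidInput env) : (Expr.floor relHeight).eval env ≠ 0 := by
  simp only [eval, ne_eq, Int.cast_eq_zero]
  exact (Int.floor_pos.2 (one_le_relHeight h)).ne'

theorem defined_choose (h : ValidInput env) {r c i s : Expr} (hr : r.Defined 8 env)
    (hc : c.Defined 8 env) (hi : i.Defined 8 env) (hs : s.Defined 8 env) :
    (choose r c i s).Defined 8 env := by
  simp only [choose, skewDet, Defined]
  simp only [defined_relWidth h, defined_relHeight h, floor_relWidth_ne_zero h, hr, hc, hi, hs,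
    ne_eq, not_false_eq_true, and_self]

theorem defined_basis (h : ValidInput env) :
    basis₀.Defined 8 env ∧ basis₁.Defined 8 env ∧ basis₂.Defined 8 env ∧ basis₃.Defined 8 env := by
  have hw : minWidth.Defined 8 env := by simp [minWidth, width₁, width₂, Defined]
  have hh : minHeight.Defined 8 env := by simp [minHeight, height₁, height₂, Defined]
  have ha := defined_relWidth h
  have hb := defined_relHeight h
  have ha' := floor_relWidth_ne_zero h
  have hb' := floor_relHeight_ne_zero h
  refine ⟨⟨hw, defined_choose h ?_ ?_ ?_ ?_⟩, ⟨hh, defined_choose h ?_ ?_ ?_ ?_⟩,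
    ⟨hw, defined_choose h ?_ ?_ ?_ ?_⟩, ⟨hh, defined_choose h ?_ ?_ ?_ ?_⟩⟩ <;>
  simp only [Defined, ha, hb, ha', hb', ne_eq, not_false_eq_true, and_self]

theorem det_basis : basis₀.eval env * basis₃.eval env - basis₁.eval env * basis₂.eval env =
    minWidth.eval env * minHeight.eval env * (relBasis₀.eval env * relBasis₃.eval env -
      relBasis₁.eval env * relBasis₂.eval env) := by
  simp only [basis₀, basis₁, basis₂, basis₃, eval]
  ring

theorem eval_density : density.eval env =
    (basis₀.eval env * basis₃.eval env - basis₁.eval env * basis₂.eval env)⁻¹ := by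
  simp [density, eval]

theorem defined_density (h : ValidInput env) : density.Defined 8 env := by
  obtain ⟨h0, h1, h2, h3⟩ := defined_basis h
  refine ⟨trivial, ⟨⟨h0, h3⟩, h1, h2⟩, ?_⟩
  obtain ⟨-, -, D, A, hD, -, -, hdet, -⟩ := relBasis_spec h
  have hpos := mul_pos (mul_pos (minWidth_pos h) (minHeight_pos h)) hD
  rw [← hdet, ← det_basis] at hpos
  exact hpos.ne'

end TwoRectangles

open RealRAM TwoRectangles

theorem corollary2 :
    (5 / 2 - Real.sqrt 2 : ℝ) < 1.086 ∧
    ∃ (prog : RealRAM.Program) (T : ℕ), ∀ R₁ R₂ : AxisRect,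
      ∃ s : RealRAM.State,
        RealRAM.HaltsWithin prog (R₁.coords ++ R₂.coords) T s ∧
        ∃ (u v : Plane) (d : ℝ),
          u = !₂[s.reg 0, s.reg 1] ∧ v = !₂[s.reg 2, s.reg 3] ∧ d = s.reg 4 ∧
          LinearIndependent ℝ ![u, v] ∧
          IsPiercing {R₁.toSet, R₂.toSet} (latticePoints u v) ∧
          0 < d ∧
          lowerDensity (latticePoints u v) = ENNReal.ofReal d ∧
          upperDensity (latticePoints u v) = ENNReal.ofReal d ∧
          piercingDensity {R₁.toSet, R₂.toSet} ≤ ENNReal.ofReal d ∧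
          ENNReal.ofReal d ≤
            ENNReal.ofReal (5 / 2 - Real.sqrt 2) * piercingDensity {R₁.toSet, R₂.toSet} := by
  refine ⟨?_, programOf 8 [basis₀, basis₁, basis₂, basis₃, density],
    (programOf 8 [basis₀, basis₁, basis₂, basis₃, density]).length,
    fun R₁ R₂ ↦ ?_⟩
  · have : 1.4142 < Real.sqrt 2 := by
      rw [Real.lt_sqrt (by norm_num)]; norm_num
    linarith
  set env : ℕ → ℝ := ((R₁.coords ++ R₂.coords).getD · 0) with henv
  have e1 : width₁.eval env = R₁.x₂ - R₁.x₁ := rfl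
  have e2 : height₁.eval env = R₁.y₂ - R₁.y₁ := rfl
  have e3 : width₂.eval env = R₂.x₂ - R₂.x₁ := rfl
  have e4 : height₂.eval env = R₂.y₂ - R₂.y₁ := rfl
  have hin : ValidInput env := by
    refine ⟨?_, ?_, ?_, ?_⟩
    · rw [e1]; exact sub_pos.2 R₁.hx
    · rw [e2]; exact sub_pos.2 R₁.hy
    · rw [e3]; exact sub_pos.2 R₂.hx
    · rw [e4]; exact sub_pos.2 R₂.hy
  have hpierce : ∀ P, IsPiercing {R₁.toSet, R₂.toSet} P ↔
      MeetsBoxes P (relWidth.eval env * minWidth.eval env) (minHeight.eval env) ∧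
        MeetsBoxes P (minWidth.eval env) (relHeight.eval env * minHeight.eval env) := fun P ↦ by
    rw [isPiercing_pair_iff, ← e1, ← e2, ← e3, ← e4]
    exact meetsBoxes_iff hin
  obtain ⟨d0, d1, d2, d3⟩ := defined_basis hin
  obtain ⟨s, hs, s0, s1, s2, s3, s4⟩ := exists_haltsWithin_programOf (N := 8) (a := basis₀)
    (b := basis₁) (c := basis₂) (d := basis₃) (e := density) (input := R₁.coords ++ R₂.coords)
    (by simpa using ⟨d0, d1, d2, d3, defined_density hin⟩)
  rw [← henv] at s0 s1 s2 s3 s4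
  obtain ⟨m1, m2, D, A, hD, hA, hAD, hdet, hlow⟩ := relBasis_spec hin
  have hw := minWidth_pos hin
  have hh := minHeight_pos hin
  have hdet' := det_basis (env := env)
  rw [hdet] at hdet'
  have hpos := mul_pos (mul_pos hw hh) hD
  have hpd : planeDet !₂[basis₀.eval env, basis₁.eval env] !₂[basis₂.eval env, basis₃.eval env] =
      minWidth.eval env * minHeight.eval env * D := by
    rw [← hdet']; simp [planeDet]
  have hpd0 := hpos.ne'
  rw [← hpd] at hpd0
  have hd : density.eval env = (minWidth.eval env * minHeight.eval env * D)⁻¹ := by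
    rw [eval_density, hdet']
  have hP : IsPiercing {R₁.toSet, R₂.toSet}
      (latticePoints !₂[basis₀.eval env, basis₁.eval env] !₂[basis₂.eval env, basis₃.eval env]) := by
    rw [hpierce]
    refine ⟨?_, ?_⟩
    · simpa [basis₀, basis₁, basis₂, basis₃, Expr.eval] using (m1.scale hw hh).meetsBoxes
    · simpa [basis₀, basis₁, basis₂, basis₃, Expr.eval] using (m2.scale hw hh).meetsBoxes
  have hl := lowerDensity_latticePoints hpd0
  have hu := upperDensity_latticePoints hpd0
  rw [hpd, abs_of_pos hpos, ← hd] at hl hu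
  refine ⟨s, hs, _, _, _, rfl, rfl, rfl, ?_⟩
  rw [s0, s1, s2, s3, s4]
  refine ⟨linearIndependent_of_planeDet_ne_zero hpd0, hP, by rw [hd]; positivity, hl, hu,
    hl ▸ iInf₂_le _ hP, ?_⟩
  have hc : 0 < 5 / 2 - Real.sqrt 2 := one_pos.trans_le one_le_ratio
  -- Moving the factor to the left leaves the bare infimum on the right, so each piercing set can be
  -- treated separately.
  rw [← ENNReal.div_le_iff' (ENNReal.ofReal_pos.2 hc).ne' ENNReal.ofReal_ne_top]
  refine le_iInf₂ fun P hP' ↦ ?_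
  rw [ENNReal.div_le_iff' (ENNReal.ofReal_pos.2 hc).ne' ENNReal.ofReal_ne_top, hd]
  obtain ⟨b1, b2⟩ := (hpierce P).1 hP'
  refine ofReal_inv_le_ratio_mul (by positivity) hpos hc.le ?_ (hlow P _ _ hw hh b1 b2)
  calc minWidth.eval env * minHeight.eval env * A
      ≤ minWidth.eval env * minHeight.eval env * ((5 / 2 - Real.sqrt 2) * D) := by gcongr
    _ = _ := by ring
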